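/- **The game.** For $n\ge 2$ let $\Gamma_n$ be the following $n$-player extensive-form stag hunt with rewards in $[0,1]$. Every player has one information set, with the two actions Stag and Hare. Chance picks $j\in\{1,\dots,n\}\cup\{\bot\}$ uniformly at random. If $j\ne\bot$, player $j$ moves and the game ends; $j$ gets $1/2$ for Hare and $0$ for Stag, and all other players get $0$. If $j=\bot$, chance picks $k\in\{1,\dots,n\}$ uniformly at random, and the players move in the order $k,k+1,\dots,n,1,\dots,k-1$; as soon as one of them plays Hare, the game ends and everyone gets $0$, and if all of them play Stag, everyone gets $1$. **Notation.** Let $Z$ be the set of terminal nodes of $\Gamma_n$. For a profile $x$ of mixed strategies, $z\sim x$ denotes sampling a terminal node when chance and the players play, $x_i[z]$ is the probability that $x_i$ selects a pure strategy playing all of $i$'s actions on the path to $z$, and $\hat x[z]=\prod_i x_i[z]$. Let $u_i(x)=\mathbb E_{z\sim x}u_i(z)$ be the expected utilities, $u_0=\sum_i u_i$ the social welfare, and $d$ the profile "everyone plays Stag". **Steering with trajectory feedback.** In each round $t=1,\dots,T$ a mediator chooses payment functions $q_i^{(t)}:Z\to[0,P]$ as a function of $T$, $t$ and the terminal nodes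 observed in earlier rounds, the players choose a profile $x^{(t)}$, and a terminal node $z^{(t)}\sim x^{(t)}$ is observed. The expected payment of player $i$ is $p_i^{(t)}(x)=\mathbb E_{z\sim x}q_i^{(t)}(z)$. The regret of player $i$ is $$\mathrm{Reg}_i^T=\frac1{P+1}\Big[\max_{y_i}\sum_{t=1}^T (u_i+p_i^{(t)})(y_i,x_{-i}^{(t)})-\sum_{t=1}^T(u_i+p_i^{(t)})(x^{(t)})\Big].$$ The players are steered to $d$ if, as $T\to\infty$, both $\max_i\frac1T\sum_{t=1}^T p_i^{(t)}(x^{(t)})$ and the directness gap $\sum_{z\in Z}\big|\frac1T\sum_{t=1}^T\hat x^{(t)}[z]-\hat d[z]\big|$ converge to $0$. **Theorem.** For every $P>0$ there is an $n$ with $2\le n\le 8P+2$ such that $\Gamma_n$ has perfect recall and at most $2(8P+3)^2$ nodes (hence, for $P\ge1$, $O(P)$ players and $O(P^2)$ nodes), $d$ is a Nash equilibrium of $\Gamma_n$, every other mixed profile has strictly smaller social welfare, and it is impossible to steer the players to $d$ with payments $q_i^{(t)}:Z\to[0,P]$, even when $R(T)=0$. More precisely, there is a rule by which the players choose $x^{(t)}$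 as a function of $(q_i^{(t)})_i$ alone, such that against every mediator, and whatever terminal nodes are observed: 1. $\mathrm{Reg}_i^T\le 0$ for every player $i$ and every $T$; 2. in every round, $u_0(d)-u_0(x^{(t)})+\sum_i p_i^{(t)}(x^{(t)})\ge\frac1{4(n+1)}$; 3. for every $T\ge1$, either the average welfare gap $u_0(d)-\frac1T\sum_{t=1}^T u_0(x^{(t)})$ or the average total payment $\frac1T\sum_{t=1}^T\sum_i p_i^{(t)}(x^{(t)})$ is at least $\frac1{4(n+1)}$; 4. the players are not steered to $d$. -/

import Mathlib

open Filter Topology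

/-- Finite extensive-form games with player set `Fin n` and rewards in `[0, 1]`, given by their
game trees. `Info i` is the set of information sets of player `i`, and `Act i I` is the set of
actions that are legal at every node of the information set `I`. A tree is either a single terminal
node with its vector of utilities, or a chance node with a fixed distribution on its finitely many
edges, or a node of player `i` in the information set `I` with one edge for each legal action. -/
inductive GameTree {n : ℕ} {Info : Fin n → Type} (Act : (i : Fin n) → Info i → Type) : Type 1
  | terminal (u : Fin n → Set.Icc (0 : ℝ) 1) : GameTree Act
  | chance {K : Type} [Fintype K] (c : stdSimplex ℝ K) (child : K → GameTree Act) : GameTree Act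
  | decision (i : Fin n) (I : Info i) (child : Act i I → GameTree Act) : GameTree Act

/-- A pure strategy of player `i`: one action for each information set. -/
abbrev PureStrategy {n : ℕ} {Info : Fin n → Type} (Act : (i : Fin n) → Info i → Type)
    (i : Fin n) : Type :=
  (I : Info i) → Act i I

namespace GameTree

section Basic

variable {n : ℕ} {Info : Fin n → Type} {Act : (i : Fin n) → Info i → Type}

/-- The type `Z` of terminal nodes: the paths from the root to the leaves. -/
def Terminal : GameTree Act → Type
  | .terminal _ => Unit
  | @chance _ _ _ K _ _ child => (a : K) × Terminal (child a)
  | .decision i I child => (a : Act i I) × Terminal (child a)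

instance instFintypeTerminal [∀ i I, Fintype (Act i I)] :
    (Γ : GameTree Act) → Fintype Γ.Terminal
  | .terminal _ => (inferInstance : Fintype Unit)
  | @chance _ _ _ K _ _ child =>
      haveI : ∀ a, Fintype (child a).Terminal := fun a => instFintypeTerminal (child a)
      (inferInstance : Fintype ((a : K) × (child a).Terminal))
  | .decision i I child =>
      haveI : ∀ a, Fintype (child a).Terminal := fun a => instFintypeTerminal (child a)
      (inferInstance : Fintype ((a : Act i I) × (child a).Terminal))

/-- The number of all nodes of the tree, terminal ones included. -/
def numNodes [∀ i I, Fintype (Act i I)] : GameTree Act → ℕ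
  | .terminal _ => 1
  | @chance _ _ _ K _ _ child => 1 + ∑ a : K, numNodes (child a)
  | .decision i I child => 1 + ∑ a : Act i I, numNodes (child a)

/-- The utility `u_i(z)` of player `i` at the terminal node `z`. -/
def utility (i : Fin n) : (Γ : GameTree Act) → Γ.Terminal → ℝ
  | .terminal u, _ => u i
  | @chance _ _ _ _ _ _ child, z => utility i (child z.1) z.2
  | .decision _ _ child, z => utility i (child z.1) z.2

/-- The probability that chance plays all its actions on the path to `z`. -/
def chanceProb : (Γ : GameTree Act) → Γ.Terminal → ℝ
  | .terminal _, _ => 1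
  | @chance _ _ _ _ _ c child, z => c z.1 * chanceProb (child z.1) z.2
  | .decision _ _ child, z => chanceProb (child z.1) z.2

/-- The sequence `σ_i(z)`: the information sets of player `i` on the path to `z`, with the actions
played there. -/
def sequence (i : Fin n) : (Γ : GameTree Act) → Γ.Terminal → List ((I : Info i) × Act i I)
  | .terminal _, _ => []
  | @chance _ _ _ _ _ _ child, z => sequence i (child z.1) z.2
  | .decision j I child, z =>
      if h : j = i then
        (h ▸ (⟨I, z.1⟩ : (I : Info j) × Act j I)) :: sequence i (child z.1) z.2
      else sequence i (child z.1) z.2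

/-- `Γ.HasNode i I σ`: there is a decision node of player `i` in the information set `I`, such that
`σ` is the sequence of player `i` on the path to this node, the node itself excluded. -/
inductive HasNode (i : Fin n) (I : Info i) : GameTree Act → List ((I : Info i) × Act i I) → Prop
  | here (child : Act i I → GameTree Act) : HasNode i I (.decision i I child) []
  | chance {K : Type} [Fintype K] (c : stdSimplex ℝ K) (child : K → GameTree Act) (a : K)
      (σ : List ((I : Info i) × Act i I)) (h : HasNode i I (child a) σ) :
      HasNode i I (.chance c child) σ
  | own (J : Info i) (child : Act i J → GameTree Act) (a : Act i J)
      (σ : List ((I : Info i) × Act i I)) (h : HasNode i I (child a) σ) :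
      HasNode i I (.decision i J child) (⟨J, a⟩ :: σ)
  | other (j : Fin n) (hj : j ≠ i) (J : Info j) (child : Act j J → GameTree Act) (a : Act j J)
      (σ : List ((I : Info i) × Act i I)) (h : HasNode i I (child a) σ) :
      HasNode i I (.decision j J child) σ

/-- Perfect recall: two nodes of a player in the same information set have the same sequence. -/
def PerfectRecall (Γ : GameTree Act) : Prop :=
  ∀ (i : Fin n) (I : Info i) (σ σ' : List ((I : Info i) × Act i I)),
    Γ.HasNode i I σ → Γ.HasNode i I σ' → σ = σ'

/-- Payment functions `q_i : Z → [0, P]`, one for each player `i`. -/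
abbrev Payments (Γ : GameTree Act) (P : ℝ) : Type :=
  Fin n → Γ.Terminal → Set.Icc (0 : ℝ) P

/-- A mediator with trajectory feedback. It knows the game and may use the time horizon `T`. In
round `t` (rounds are numbered `0, …, T - 1`) it chooses the payment functions from the terminal
nodes that were observed in the rounds before `t`. -/
abbrev TrajectoryMediator (Γ : GameTree Act) (P : ℝ) : Type :=
  (T t : ℕ) → (Fin t → Γ.Terminal) → Γ.Payments P

/-- The payment functions that the mediator `M` uses, in round `t` of the play with horizon `T`,
when `z T s` is the terminal node that is observed in round `s` of the play with horizon `T`. -/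
def TrajectoryMediator.payments {Γ : GameTree Act} {P : ℝ} (M : Γ.TrajectoryMediator P)
    (z : ℕ → ℕ → Γ.Terminal) (T t : ℕ) : Γ.Payments P :=
  M T t (fun s => z T s)

end Basic

section Strategies

variable {n : ℕ} {Info : Fin n → Type} [∀ i, Fintype (Info i)] [∀ i, DecidableEq (Info i)]
  {Act : (i : Fin n) → Info i → Type} [∀ i I, Fintype (Act i I)] [∀ i I, DecidableEq (Act i I)]

variable (Act) in
/-- A mixed strategy of player `i`: a distribution over the pure strategies. -/
abbrev MixedStrategy (i : Fin n) : Type :=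
  stdSimplex ℝ (PureStrategy Act i)

variable (Act) in
/-- A profile of mixed strategies. -/
abbrev Profile : Type :=
  (i : Fin n) → MixedStrategy Act i

/-- A profile of pure strategies, as a profile of mixed strategies. -/
def pureProfile (d : (i : Fin n) → PureStrategy Act i) : Profile Act :=
  fun i => ⟨Pi.single (d i) 1, single_mem_stdSimplex ℝ (d i)⟩

/-- The sequence form `x_i[z]` of a mixed strategy: the probability with which it selects a pure
strategy that plays all actions of player `i` on the path to `z`. -/
noncomputable def seqForm (Γ : GameTree Act) {i : Fin n} (x : MixedStrategy Act i)
    (z : Γ.Terminal) : ℝ :=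
  ∑ s : PureStrategy Act i, if ∀ p ∈ Γ.sequence i z, s p.1 = p.2 then x s else 0

/-- `x̂[z] = ∏ i, x_i[z]`. -/
noncomputable def hatProd (Γ : GameTree Act) (x : Profile Act) (z : Γ.Terminal) : ℝ :=
  ∏ i, Γ.seqForm (x i) z

/-- The expectation of `f(z)`, where the terminal node `z` is sampled from the profile `x`. -/
noncomputable def expect (Γ : GameTree Act) (x : Profile Act) (f : Γ.Terminal → ℝ) : ℝ :=
  ∑ z, Γ.chanceProb z * Γ.hatProd x z * f z

/-- The expected utility `u_i(x)`. -/
noncomputable def expUtility (Γ : GameTree Act) (i : Fin n) (x : Profile Act) : ℝ :=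
  Γ.expect x (Γ.utility i)

/-- The expected payment `p_i(x)` to player `i`, for the payment functions `q`. -/
noncomputable def expPayment (Γ : GameTree Act) {P : ℝ} (q : Γ.Payments P) (i : Fin n)
    (x : Profile Act) : ℝ :=
  Γ.expect x (fun z => q i z)

/-- The social welfare `u_0(x) = ∑ i, u_i(x)`. -/
noncomputable def welfare (Γ : GameTree Act) (x : Profile Act) : ℝ :=
  ∑ i, Γ.expUtility i x

/-- Nash equilibrium: no player gains by deviating to another mixed strategy. -/
def IsNash (Γ : GameTree Act) (x : Profile Act) : Prop :=
  ∀ (i : Fin n) (y : MixedStrategy Act i),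
    Γ.expUtility i (Function.update x i y) ≤ Γ.expUtility i x

/-- The regret of player `i` after the rounds `0, …, T - 1`, with payment functions `q t` and
profiles `x t`; it takes the payments into account and is normalized by `1 / (P + 1)`. (The supremum
is a maximum, of a linear function on the simplex of mixed strategies.) -/
noncomputable def regret (Γ : GameTree Act) {P : ℝ} (q : ℕ → Γ.Payments P) (x : ℕ → Profile Act)
    (T : ℕ) (i : Fin n) : ℝ :=
  1 / (P + 1) *
    ((⨆ y : MixedStrategy Act i, ∑ t ∈ Finset.range T,
        (Γ.expUtility i (Function.update (x t) i y)
          + Γ.expPayment (q t) i (Function.update (x t) i y)))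
      - ∑ t ∈ Finset.range T, (Γ.expUtility i (x t) + Γ.expPayment (q t) i (x t)))

/-- The time-averaged realized payment to player `i` over the rounds `0, …, T - 1`. -/
noncomputable def avgPayment (Γ : GameTree Act) {P : ℝ} (q : ℕ → Γ.Payments P)
    (x : ℕ → Profile Act) (T : ℕ) (i : Fin n) : ℝ :=
  1 / (T : ℝ) * ∑ t ∈ Finset.range T, Γ.expPayment (q t) i (x t)

/-- The directness gap with respect to `d` over the rounds `0, …, T - 1`: the `ℓ¹`-distance of the
time average of `x̂` to `d̂`. -/
noncomputable def directnessGap (Γ : GameTree Act) (d : Profile Act) (x : ℕ → Profile Act)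
    (T : ℕ) : ℝ :=
  ∑ z, |1 / (T : ℝ) * (∑ t ∈ Finset.range T, Γ.hatProd (x t) z) - Γ.hatProd d z|

/-- The time average of the welfare gap to `d` over the rounds `0, …, T - 1`. -/
noncomputable def avgWelfareGap (Γ : GameTree Act) (d : Profile Act) (x : ℕ → Profile Act)
    (T : ℕ) : ℝ :=
  Γ.welfare d - 1 / (T : ℝ) * ∑ t ∈ Finset.range T, Γ.welfare (x t)

/-- The two desiderata of steering toward `d`, where `q T t` and `x T t` are the payment functions
and the profile in round `t` of the play with horizon `T`: as `T → ∞`, the largest time-averaged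
payment to a player and the directness gap both converge to `0`. -/
def Steered (Γ : GameTree Act) (d : Profile Act) {P : ℝ} (q : ℕ → ℕ → Γ.Payments P)
    (x : ℕ → ℕ → Profile Act) : Prop :=
  Tendsto (fun T => ⨆ i, Γ.avgPayment (q T) (x T) T i) atTop (𝓝 0) ∧
    Tendsto (fun T => Γ.directnessGap d (x T) T) atTop (𝓝 0)

end Strategies

end GameTree

/-- The two actions of the stag hunt. -/
inductive StagHuntAction : Type
  | stag
  | hare
  deriving DecidableEq

instance instFintypeStagHuntAction : Fintype StagHuntAction :=
  ⟨{StagHuntAction.stag, StagHuntAction.hare}, fun a => by cases a <;> simp⟩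

/-- The action sets of the stag hunt: every player has a single information set, with the two
actions Stag and Hare. -/
abbrev StagHuntAct (n : ℕ) (_ : Fin n) (_ : Unit) : Type :=
  StagHuntAction

/-- The uniform distribution on a finite non-empty set. -/
noncomputable def uniformDist (K : Type) [Fintype K] [Nonempty K] : stdSimplex ℝ K :=
  ⟨fun _ => 1 / (Fintype.card K : ℝ), fun _ => by positivity, by simp⟩

/-- The players in the list move in this order. As soon as one of them plays Hare, the game ends
and everyone gets `0`; if all of them play Stag, everyone gets `1`. -/
def stagHuntChain {n : ℕ} : List (Fin n) → GameTree (StagHuntAct n)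
  | [] => .terminal (fun _ => 1)
  | i :: l => .decision i () (fun a =>
      match a with
      | .stag => stagHuntChain l
      | .hare => .terminal (fun _ => 0))

/-- The `n`-player extensive-form stag hunt. Chance picks `j ∈ {1, …, n} ∪ {⊥}` uniformly at random.
If `j` is a player, then `j` moves, and gets `1 / 2` for Hare and `0` for Stag, while all others get
`0`. If `j = ⊥`, then chance picks a player `k` uniformly at random, and the players move in the
order `k, k + 1, …, n, 1, …, k - 1` until somebody plays Hare; they all get `1` if everybody plays
Stag, and `0` otherwise. All nodes of a player are in one information set. -/
noncomputable def stagHunt (n : ℕ) [NeZero n] : GameTree (StagHuntAct n) :=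
  .chance (uniformDist (Option (Fin n))) (fun j =>
    match j with
    | some j => .decision j () (fun a =>
        match a with
        | .stag => .terminal (fun _ => 0)
        | .hare => .terminal (fun i => if i = j then ⟨1 / 2, Set.mem_Icc.2 (by norm_num)⟩ else 0))
    | none => .chance (uniformDist (Fin n)) (fun k =>
        stagHuntChain ((List.finRange n).rotate k)))

/-- The profile in which everyone plays Stag. -/
def allStag (n : ℕ) : GameTree.Profile (StagHuntAct n) :=
  GameTree.pureProfile (fun _ _ => StagHuntAction.stag)

/-! The players answer the payments of each round with a Nash equilibrium of the game that includes
these payments, chosen so as to be bad for the mediator. Playing equilibria in every round makes all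
regrets non-positive, so it suffices to find, for every `q`, an equilibrium with a welfare gap or a
total payment of order `1 / (n + 1)`.

The relevant payment is the one to `i` at the node where chance picks `i` alone and `i` plays Stag.
If it is at most `3/8` for every `i`, everyone playing Hare is an equilibrium. Deviating to Stag
costs `1/2` in the solo branch and earns there at most `3/8`. In the cooperative branch the
deviation is visible only if the deviator moves first, which has conditional probability `1/n`, and
so it earns at most `P/n ≤ 1/8`. This is the reason for the random starting player and for `n ≥ 8P`
(`expPayment_update_allHare_le`). If instead the payment exceeds `3/8` for some `i`, any equilibrium
will do. When `i` plays Stag with probability `p`, the welfare gap is at least `(1 - p)/(n + 1)`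
(`le_welfareGap`) and the payment at least `(3/8)p/(n + 1)` (`le_expPayment`), and the two cannot
both be small.

The second case needs Nash's theorem. With two actions per player a profile is a point of a cube, so
Nash's theorem follows from `poincare_miranda`. That theorem is derived from the Steinhaus–Kuhn
lemma, which is proved by a mod-2 count of labelled lattice paths: the count does not change when
one label function is replaced (`labelledPathSum_update`), and it is `1` for the simplest labelling.
-/

/-! ### Labelled lattice paths modulo 2 and the Steinhaus–Kuhn lemma -/

/-- The `j`-th vertex of the monotone lattice path that starts at `x` and makes unit steps in the
directions `π 0, π 1, …`. -/
def latticePath {n : ℕ} (x : Fin n → ℕ) (π : Equiv.Perm (Fin n)) (j : ℕ) : Fin n → ℕ :=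
  fun c => x c + if (π.symm c : ℕ) < j then 1 else 0

/-- Interchanging two consecutive steps flips the path across a square, which moves only the vertex
between the two steps. -/
theorem latticePath_mul_swap {n : ℕ} (x : Fin n → ℕ) (π : Equiv.Perm (Fin n)) {j : ℕ}
    (hj : j + 1 < n) {i : ℕ} (hi : i ≠ j + 1) :
    latticePath x (π * Equiv.swap ⟨j, by omega⟩ ⟨j + 1, hj⟩) i = latticePath x π i := by
  funext c
  simp only [latticePath]
  congr 1
  have : ((π * Equiv.swap (⟨j, by omega⟩ : Fin n) ⟨j + 1, hj⟩).symm c : ℕ) < i ↔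
      (π.symm c : ℕ) < i := by
    have h : (π * Equiv.swap (⟨j, by omega⟩ : Fin n) ⟨j + 1, hj⟩).symm c
        = Equiv.swap (⟨j, by omega⟩ : Fin n) ⟨j + 1, hj⟩ (π.symm c) := by
      rw [Equiv.symm_apply_eq]; simp
    rw [h, Equiv.swap_apply_def]
    split_ifs with h1 h2
    · rw [h1]; simp only; omega
    · rw [h2]; simp only; omega
    · rfl
  simp only [this]

/-- An edge factor can be moved across a vertex that the other factors do not use. -/
theorem sum_perm_mul_edge {n : ℕ} (x : Fin n → ℕ) {j : ℕ} (hj : j + 1 < n)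
    (a : (Fin n → ℕ) → ZMod 2) (rest : Equiv.Perm (Fin n) → ZMod 2)
    (hrest : ∀ π, rest (π * Equiv.swap ⟨j, by omega⟩ ⟨j + 1, hj⟩) = rest π) :
    ∑ π, rest π * (a (latticePath x π (j + 1)) + a (latticePath x π j)) =
      ∑ π, rest π * (a (latticePath x π (j + 2)) + a (latticePath x π (j + 1))) := by
  rw [← sub_eq_zero, ← Finset.sum_sub_distrib]
  refine Finset.sum_involution
    (fun π _ => π * Equiv.swap ⟨j, by omega⟩ ⟨j + 1, hj⟩) ?_ ?_ ?_ ?_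
  · intro π _
    -- Modulo 2 the vertex `j + 1` cancels from the difference of the two summands. What is left is
    -- unchanged by the swap, so `π` and its partner contribute twice the same value.
    rw [hrest, latticePath_mul_swap x π hj (i := j) (by omega),
      latticePath_mul_swap x π hj (i := j + 2) (by omega)]
    generalize a _ = b1
    generalize a _ = b2
    generalize a _ = b3
    generalize a _ = b4
    generalize rest π = b5
    revert b1 b2 b3 b4 b5
    decide
  · intro π _ _ h
    have := mul_eq_left.1 h
    rw [Equiv.swap_eq_one_iff] at this
    simp at this
  · simp
  · intro π _
    simp [mul_assoc]

/-- The sum over a box is invariant under a shift along an axis, for a function that vanishes on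
the two faces orthogonal to this axis. -/
theorem sum_box_shift {n : ℕ} (m : ℕ) (c : Fin n) (G : (Fin n → ℕ) → ZMod 2)
    (h0 : ∀ x, x c = 0 → G x = 0) (hm : ∀ x, x c = m → G x = 0) :
    ∑ x ∈ Fintype.piFinset (fun _ : Fin n => Finset.range m), G (x + Pi.single c 1) =
      ∑ x ∈ Fintype.piFinset (fun _ : Fin n => Finset.range m), G x := by
  refine Finset.sum_bij_ne_zero (fun x _ _ => x + Pi.single c 1) ?_ ?_ ?_ ?_
  · intro x hx hG
    simp only [Fintype.mem_piFinset, Finset.mem_range] at hx ⊢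
    intro i
    by_cases hi : i = c
    · subst hi
      have := mt (hm _) hG
      have := hx i
      simp only [Pi.add_apply, Pi.single_eq_same] at *
      omega
    · simpa [hi] using hx i
  · intro x _ _ y _ _ h
    exact add_right_cancel h
  · intro x hx hG
    have hc := mt (h0 _) hG
    have hxx : x - Pi.single c 1 + Pi.single c 1 = x := by
      funext i
      by_cases hi : i = c
      · subst hi; simp; omega
      · simp [hi]
    refine ⟨x - Pi.single c 1, ?_, ?_, hxx⟩
    · simp only [Fintype.mem_piFinset, Finset.mem_range] at hx ⊢
      intro i
      have := hx i
      simp only [Pi.sub_apply]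
      omega
    · rwa [hxx]
  · intros; rfl

/-- Without its first edge, a path is an initial part of the path from the next vertex with
cyclically rotated directions; the dropped direction `π 0` comes last. -/
theorem latticePath_succ {n : ℕ} (x : Fin (n + 1) → ℕ) (π : Equiv.Perm (Fin (n + 1))) {j : ℕ}
    (hj : j ≤ n) :
    latticePath x π (j + 1) =
      latticePath (x + Pi.single (π 0) 1) (π * finRotate (n + 1)) j := by
  funext c
  obtain ⟨i, rfl⟩ := (π * finRotate (n + 1)).surjective c
  have h1 : π.symm ((π * finRotate (n + 1)) i) = finRotate (n + 1) i := by simp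
  simp only [latticePath, h1, Equiv.symm_apply_apply, Pi.add_apply]
  by_cases hi : i = Fin.last n
  · subst hi
    simp
    omega
  · have h2 := coe_finRotate_of_ne_last hi
    have h3 : (π * finRotate (n + 1)) i ≠ π 0 := by
      intro h
      have h4 := π.injective h
      rw [h4] at h2
      simp at h2
    rw [h2, Pi.single_eq_of_ne h3]
    simp only [add_zero, Nat.add_lt_add_iff_right]

/-- The mod-2 count of the completely labelled lattice paths of the box `{0, …, m}ⁿ`. -/
def labelledPathSum {n : ℕ} (m : ℕ) (a : Fin n → (Fin n → ℕ) → ZMod 2) : ZMod 2 :=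
  ∑ x ∈ Fintype.piFinset (fun _ : Fin n => Finset.range m), ∑ π : Equiv.Perm (Fin n),
    ∏ l : Fin n, (a l (latticePath x π (l + 1)) + a l (latticePath x π l))

/-- The labels `l < k` sit on the edges `l` (for `l < j`) or `l + 1` (for `j ≤ l`). -/
theorem sum_perm_skip_up {n : ℕ} (x : Fin n → ℕ) (k : Fin n) (h : (Fin n → ℕ) → ZMod 2)
    (a : Fin n → (Fin n → ℕ) → ZMod 2) (j : ℕ) (hj : j ≤ k) :
    ∑ π : Equiv.Perm (Fin n), ∏ l : Fin n,
      (if l = k then h (latticePath x π (k + 1)) else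
        if j ≤ l ∧ l < k then a l (latticePath x π (l + 2)) + a l (latticePath x π (l + 1))
        else a l (latticePath x π (l + 1)) + a l (latticePath x π l)) =
    ∑ π : Equiv.Perm (Fin n), ∏ l : Fin n,
      (if l = k then h (latticePath x π (k + 1)) else
        if l < k then a l (latticePath x π (l + 2)) + a l (latticePath x π (l + 1))
        else a l (latticePath x π (l + 1)) + a l (latticePath x π l)) := by
  induction j with
  | zero => simp
  | succ j ih =>
    rw [← ih (by omega)]
    have hjn : j + 1 < n := by omega
    let J : Fin n := ⟨j, by omega⟩
    let rest : Equiv.Perm (Fin n) → ZMod 2 := fun π => ∏ l ∈ Finset.univ.erase J,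
      (if l = k then h (latticePath x π (k + 1)) else
        if j ≤ l ∧ l < k then a l (latticePath x π (l + 2)) + a l (latticePath x π (l + 1))
        else a l (latticePath x π (l + 1)) + a l (latticePath x π l))
    have hJk : J ≠ k := by intro e; have := congrArg Fin.val e; simp [J] at this; omega
    have key := sum_perm_mul_edge x hjn (a J) rest (by
      intro π
      refine Finset.prod_congr rfl fun l hl => ?_
      have hl' : (l : ℕ) ≠ j := fun e => (Finset.mem_erase.1 hl).1 (Fin.ext e)
      rw [latticePath_mul_swap x π hjn (i := k + 1) (by omega)]
      split_ifs with h1 h2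
      · rfl
      · rw [latticePath_mul_swap x π hjn (by omega), latticePath_mul_swap x π hjn (by omega)]
      · have : ¬ (l : ℕ) = j + 1 := by
          intro e
          have : (l : ℕ) ≠ k := fun e => h1 (Fin.ext e)
          exact h2 ⟨by omega, by rw [Fin.lt_def]; omega⟩
        rw [latticePath_mul_swap x π hjn (by omega), latticePath_mul_swap x π hjn (by omega)])
    convert key using 2 with π _ π _
    · rw [← Finset.prod_erase_mul _ _ (Finset.mem_univ J)]
      congr 1
      · refine Finset.prod_congr rfl fun l hl => ?_
        have hl' : (l : ℕ) ≠ j := fun e => (Finset.mem_erase.1 hl).1 (Fin.ext e)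
        have : (j + 1 ≤ (l : ℕ) ∧ l < k) ↔ (j ≤ (l : ℕ) ∧ l < k) := by omega
        simp only [this]
      · simp [hJk, J]
    · rw [← Finset.prod_erase_mul _ _ (Finset.mem_univ J)]
      congr 1
      have : J < k := by rw [Fin.lt_def]; simp [J]; omega
      simp [hJk, this]
      simp [J]

/-- The labels `l > k` sit on the edges `l` (for `j < l`) or `l - 1` (for `l ≤ j`). -/
theorem sum_perm_skip_down {n : ℕ} (x : Fin n → ℕ) (k : Fin n) (h : (Fin n → ℕ) → ZMod 2)
    (a : Fin n → (Fin n → ℕ) → ZMod 2) (j : ℕ) (hkj : k ≤ j) (hj : j < n) :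
    ∑ π : Equiv.Perm (Fin n), ∏ l : Fin n,
      (if l = k then h (latticePath x π k) else
        if l ≤ j ∧ k < l then a l (latticePath x π l) + a l (latticePath x π (l - 1))
        else a l (latticePath x π (l + 1)) + a l (latticePath x π l)) =
    ∑ π : Equiv.Perm (Fin n), ∏ l : Fin n,
      (if l = k then h (latticePath x π k) else
        a l (latticePath x π (l + 1)) + a l (latticePath x π l)) := by
  induction j, hkj using Nat.le_induction with
  | base =>
    refine Finset.sum_congr rfl fun π _ => Finset.prod_congr rfl fun l _ => ?_
    have : ¬ ((l : ℕ) ≤ k ∧ k < l) := by rw [Fin.lt_def]; omega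
    simp only [this, if_false]
  | succ j hkj ih =>
    rw [← ih (by omega)]
    let J : Fin n := ⟨j + 1, hj⟩
    let rest : Equiv.Perm (Fin n) → ZMod 2 := fun π => ∏ l ∈ Finset.univ.erase J,
      (if l = k then h (latticePath x π k) else
        if l ≤ j ∧ k < l then a l (latticePath x π l) + a l (latticePath x π (l - 1))
        else a l (latticePath x π (l + 1)) + a l (latticePath x π l))
    have hJk : J ≠ k := by intro e; have := congrArg Fin.val e; simp [J] at this; omega
    have key := sum_perm_mul_edge x hj (a J) rest (by
      intro π
      refine Finset.prod_congr rfl fun l hl => ?_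
      have hl' : (l : ℕ) ≠ j + 1 := fun e => (Finset.mem_erase.1 hl).1 (Fin.ext e)
      rw [latticePath_mul_swap x π hj (i := k) (by omega)]
      split_ifs with h1 h2
      · rfl
      · rw [latticePath_mul_swap x π hj (by omega), latticePath_mul_swap x π hj (by omega)]
      · have : ¬ (l : ℕ) = j := by
          intro e
          have : (l : ℕ) ≠ k := fun e => h1 (Fin.ext e)
          exact h2 ⟨by omega, by rw [Fin.lt_def]; omega⟩
        rw [latticePath_mul_swap x π hj (by omega), latticePath_mul_swap x π hj (by omega)])
    have hkJ : k < J := by rw [Fin.lt_def]; simp [J]; omega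
    convert key using 2 with π _ π _
    · rw [← Finset.prod_erase_mul _ _ (Finset.mem_univ J)]
      congr 1
      · refine Finset.prod_congr rfl fun l hl => ?_
        have hl' : (l : ℕ) ≠ j + 1 := fun e => (Finset.mem_erase.1 hl).1 (Fin.ext e)
        have : ((l : ℕ) ≤ j + 1 ∧ k < l) ↔ ((l : ℕ) ≤ j ∧ k < l) := by omega
        simp only [this]
      · simp [hJk, hkJ]
        simp [J]
    · rw [← Finset.prod_erase_mul _ _ (Finset.mem_univ J)]
      congr 1
      simp [hJk, J]

/-- Labels of the vertices of the box `{0, …, m}ⁿ` that separate opposite faces. -/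
def SeparatesFaces {n : ℕ} (m : ℕ) (a : Fin n → (Fin n → ℕ) → ZMod 2) : Prop :=
  ∀ l x, (x l = 0 → a l x = 0) ∧ (x l = m → a l x = 1)

/-- Replacing `a k` changes the product on a path by terms with `h = b - a k` at the two ends of
edge `k`. With `h` at the upper end, the labels below `k` move up one edge and free the first edge;
with `h` at the lower end, the labels above `k` move down and free the last edge. Both sums then run
over the same shortened paths. Each of these lies in a facet of a unit cube: interior facets are met
from both sides and cancel modulo 2, facets on the boundary of the box contribute zero. -/
theorem labelledPathSum_update {n : ℕ} {m : ℕ} {a : Fin n → (Fin n → ℕ) → ZMod 2}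
    {k : Fin n} {b : (Fin n → ℕ) → ZMod 2} (ha : SeparatesFaces m a)
    (hb : SeparatesFaces m (Function.update a k b)) :
    labelledPathSum m (Function.update a k b) = labelledPathSum m a := by
  obtain ⟨n, rfl⟩ : ∃ N, n = N + 1 := ⟨n - 1, by have := k.2; omega⟩
  rw [← sub_eq_zero]
  simp only [labelledPathSum, ← Finset.sum_sub_distrib]
  let h : (Fin (n + 1) → ℕ) → ZMod 2 := fun y => b y - a k y
  have h0 : ∀ y, y k = 0 ∨ y k = m → h y = 0 := by
    rintro y (hy | hy)
    · have := (hb k y).1 hy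
      simp only [Function.update_self] at this
      simp [h, this, (ha k y).1 hy]
    · have := (hb k y).2 hy
      simp only [Function.update_self] at this
      simp [h, this, (ha k y).2 hy]
  have hab : ∀ l y y', (y l = 0 ∧ y' l = 0) ∨ (y l = m ∧ y' l = m) → a l y + a l y' = 0 := by
    rintro l y y' (⟨h1, h2⟩ | ⟨h1, h2⟩)
    · simp [(ha l y).1 h1, (ha l y').1 h2]
    · rw [(ha l y).2 h1, (ha l y').2 h2]; decide
  -- The weight of a shortened path: the last edge carries no label, and vertex `k` carries `h`.
  let F : (ℕ → Fin (n + 1) → ℕ) → ZMod 2 := fun w => ∏ l : Fin (n + 1),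
    (if l = k then h (w k) else
      if l < k then a l (w (l + 1)) + a l (w l) else a l (w l) + a l (w (l - 1)))
  have hsplit : ∀ x (π : Equiv.Perm (Fin (n + 1))),
      ((∏ l : Fin (n + 1), (Function.update a k b l (latticePath x π (l + 1))
          + Function.update a k b l (latticePath x π l)))
        - ∏ l : Fin (n + 1), (a l (latticePath x π (l + 1)) + a l (latticePath x π l))) =
      (∏ l : Fin (n + 1), (if l = k then h (latticePath x π (k + 1)) else
        a l (latticePath x π (l + 1)) + a l (latticePath x π l)))
      + ∏ l : Fin (n + 1), (if l = k then h (latticePath x π k) else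
        a l (latticePath x π (l + 1)) + a l (latticePath x π l)) := by
    intro x π
    simp only [← Finset.prod_erase_mul _ _ (Finset.mem_univ k)]
    have e1 : ∀ f : Fin (n + 1) → ZMod 2, (∏ l ∈ Finset.univ.erase k, if l = k then f k else
        a l (latticePath x π (l + 1)) + a l (latticePath x π l)) =
        ∏ l ∈ Finset.univ.erase k, (a l (latticePath x π (l + 1)) + a l (latticePath x π l)) :=
      fun f => Finset.prod_congr rfl fun l hl => by simp [(Finset.mem_erase.1 hl).1]
    have e2 : (∏ l ∈ Finset.univ.erase k, (Function.update a k b l (latticePath x π (l + 1))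
          + Function.update a k b l (latticePath x π l))) =
        ∏ l ∈ Finset.univ.erase k, (a l (latticePath x π (l + 1)) + a l (latticePath x π l)) :=
      Finset.prod_congr rfl fun l hl => by simp [(Finset.mem_erase.1 hl).1]
    rw [e1 (fun _ => h (latticePath x π (k + 1))), e1 (fun _ => h (latticePath x π k)), e2]
    simp only [Function.update_self, if_true, h]
    ring
  simp only [hsplit, Finset.sum_add_distrib]
  have hup : ∀ x, ∑ π : Equiv.Perm (Fin (n + 1)),
      (∏ l : Fin (n + 1), (if l = k then h (latticePath x π (k + 1)) else
        a l (latticePath x π (l + 1)) + a l (latticePath x π l))) =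
      ∑ π : Equiv.Perm (Fin (n + 1)),
        F (latticePath (x + Pi.single (π 0) 1) (π * finRotate (n + 1))) := by
    intro x
    refine Eq.trans (Finset.sum_congr rfl fun π _ => Finset.prod_congr rfl fun l _ => ?_)
      ((sum_perm_skip_up x k h a k le_rfl).trans
        (Finset.sum_congr rfl fun π _ => Finset.prod_congr rfl fun l _ => ?_))
    · have : ¬ ((k : ℕ) ≤ l ∧ l < k) := by rw [Fin.lt_def]; omega
      simp only [this, if_false]
    have hl := l.2
    have hk := k.2
    rw [latticePath_succ x π (by omega : (k : ℕ) ≤ n)]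
    split_ifs with h1 h2
    · rfl
    · rw [Fin.lt_def] at h2
      rw [latticePath_succ x π (by omega : (l : ℕ) + 1 ≤ n),
        latticePath_succ x π (by omega : (l : ℕ) ≤ n)]
    · have h3 : (l : ℕ) ≠ k := fun e => h1 (Fin.ext e)
      rw [Fin.lt_def] at h2
      obtain ⟨i, hi⟩ : ∃ i, (l : ℕ) = i + 1 := ⟨l - 1, by omega⟩
      rw [latticePath_succ x π (by omega : (l : ℕ) ≤ n), hi,
        latticePath_succ x π (by omega : i ≤ n), Nat.add_sub_cancel]
  have hdown : ∀ x, ∑ π : Equiv.Perm (Fin (n + 1)),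
      (∏ l : Fin (n + 1), (if l = k then h (latticePath x π k) else
        a l (latticePath x π (l + 1)) + a l (latticePath x π l))) =
      ∑ π : Equiv.Perm (Fin (n + 1)), F (latticePath x π) := by
    intro x
    rw [← sum_perm_skip_down x k h a n (by omega) (by omega)]
    refine Finset.sum_congr rfl fun π _ => Finset.prod_congr rfl fun l _ => ?_
    by_cases h1 : l = k
    · simp [h1]
    have h3 : (l : ℕ) ≠ k := fun e => h1 (Fin.ext e)
    by_cases h2 : l < k
    · simp [h1, h2, not_lt_of_gt h2]
    · have h4 : k < l := by rw [Fin.lt_def] at *; omega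
      have : (l : ℕ) ≤ n := by omega
      simp [h1, h2, h4, this]
  simp only [hup, hdown]
  -- A path without its last edge is constant in the last direction `c`. On a boundary face
  -- orthogonal to `c` the factor with index `c` vanishes: it is a value of `h` if `c = k`, and
  -- otherwise a sum of two equal values of `a c`.
  have hface : ∀ (π : Equiv.Perm (Fin (n + 1))) x,
      x (π (Fin.last n)) = 0 ∨ x (π (Fin.last n)) = m → F (latticePath x π) = 0 := by
    intro π x hx
    set c := π (Fin.last n) with hc
    have hpath : ∀ j ≤ n, latticePath x π j c = x c := by
      intro j hj
      simp [latticePath, hc]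
      omega
    have hcn := c.2
    refine Finset.prod_eq_zero (Finset.mem_univ c) ?_
    split_ifs with h1 h2
    · apply h0
      rw [← h1, hpath _ (by omega)]
      exact hx
    · apply hab
      rw [Fin.lt_def] at h2
      rw [hpath _ (by omega), hpath _ (by omega)]
      simpa using hx
    · apply hab
      rw [hpath _ (by omega), hpath _ (by omega)]
      simpa using hx
  have hshift : ∑ x ∈ Fintype.piFinset (fun _ : Fin (n + 1) => Finset.range m),
        ∑ π : Equiv.Perm (Fin (n + 1)),
          F (latticePath (x + Pi.single (π 0) 1) (π * finRotate (n + 1))) =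
      ∑ x ∈ Fintype.piFinset (fun _ : Fin (n + 1) => Finset.range m),
        ∑ π : Equiv.Perm (Fin (n + 1)), F (latticePath x π) := by
    refine Finset.sum_comm.trans (Eq.trans ?_ Finset.sum_comm)
    refine Eq.trans (Finset.sum_congr rfl fun π _ => ?_)
      (Equiv.sum_comp (Equiv.mulRight (finRotate (n + 1)))
        (fun π => ∑ x ∈ Fintype.piFinset (fun _ : Fin (n + 1) => Finset.range m),
          F (latticePath x π)))
    rw [Equiv.coe_mulRight]
    have hlast : (π * finRotate (n + 1)) (Fin.last n) = π 0 := by simp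
    exact sum_box_shift m (π 0) (fun x => F (latticePath x (π * finRotate (n + 1))))
      (fun x hx => hface _ x (by rw [hlast]; exact Or.inl hx))
      (fun x hx => hface _ x (by rw [hlast]; exact Or.inr hx))
  rw [hshift]
  exact CharTwo.add_self_eq_zero _

/-- Label `l` changes along edge `l` only if step `l` goes in direction `l` and starts from
coordinate `m - 1`. So the identity permutation in the top corner cube is the only contribution. -/
theorem labelledPathSum_indicator {n m : ℕ} (hm : 0 < m) :
    labelledPathSum (n := n) m (fun l x => if x l = m then 1 else 0) = 1 := by
  have hfac : ∀ (x : Fin n → ℕ) (π : Equiv.Perm (Fin n)) (l : Fin n), x l < m →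
      ¬ (π l = l ∧ x l = m - 1) →
      ((if latticePath x π (l + 1) l = m then 1 else 0)
        + (if latticePath x π l l = m then 1 else 0) : ZMod 2) = 0 := by
    intro x π l hx hne
    by_cases hπ : π l = l
    · have h1 : π.symm l = l := by rw [Equiv.symm_apply_eq, hπ]
      have h2 : ¬ (x l + 1 = m) := fun e => hne ⟨hπ, by omega⟩
      simp [latticePath, h1, h2, hx.ne]
    · have h1 : (π.symm l : ℕ) ≠ l := fun e => hπ (by
        have : π.symm l = l := Fin.ext e
        rw [Equiv.symm_apply_eq] at this; exact this.symm)
      have : (π.symm l : ℕ) < l + 1 ↔ (π.symm l : ℕ) < l := by omega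
      simp only [latticePath, this]
      exact CharTwo.add_self_eq_zero _
  unfold labelledPathSum
  rw [Finset.sum_eq_single (fun _ => m - 1), Finset.sum_eq_single 1]
  · refine Finset.prod_eq_one fun l _ => ?_
    have h1 : m - 1 + 1 = m := by omega
    have h2 : m - 1 ≠ m := by omega
    have h3 : (1 : Equiv.Perm (Fin n)).symm l = l := rfl
    simp [latticePath, h1, h2, h3]
  · intro π _ hπ
    obtain ⟨l, hl⟩ : ∃ l, π l ≠ l := by
      by_contra! h
      exact hπ (Equiv.ext h)
    exact Finset.prod_eq_zero (Finset.mem_univ l) (hfac _ π l (by omega) (fun e => hl e.1))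
  · simp
  · intro x hx hne
    obtain ⟨l, hl⟩ := Function.ne_iff.1 hne
    simp only [Fintype.mem_piFinset, Finset.mem_range] at hx
    exact Finset.sum_eq_zero fun π _ =>
      Finset.prod_eq_zero (Finset.mem_univ l) (hfac x π l (hx l) (fun e => hl e.2))
  · intro h
    exact (h (by simp [hm])).elim

/-- The labels are exchanged for the indicators of the top faces one at a time; separation of faces
is a condition on each label by itself, so it survives in every mixture. -/
theorem labelledPathSum_eq_one {n m : ℕ} (hm : 0 < m) {a : Fin n → (Fin n → ℕ) → ZMod 2}
    (ha : SeparatesFaces m a) : labelledPathSum m a = 1 := by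
  let b : Fin n → (Fin n → ℕ) → ZMod 2 := fun l x => if x l = m then 1 else 0
  have hb : SeparatesFaces m b := fun l x => ⟨fun h => by simp [b, h, hm.ne], fun h => by simp [b, h]⟩
  have hS : ∀ S : Finset (Fin n), SeparatesFaces m (S.piecewise b a) := fun S l x => by
    by_cases h : l ∈ S
    · simpa [h] using hb l x
    · simpa [h] using ha l x
  have key : ∀ S : Finset (Fin n), labelledPathSum m (S.piecewise b a) = labelledPathSum m a := by
    intro S
    induction S using Finset.induction_on with
    | empty => simp
    | insert k S _ ih =>
      have := hS (insert k S)
      rw [Finset.piecewise_insert] at this ⊢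
      rw [labelledPathSum_update (hS S) this, ih]
  rw [← key Finset.univ, Finset.piecewise_univ]
  exact labelledPathSum_indicator hm

/-- The Steinhaus–Kuhn lemma: some unit cube of the box sees both values of every label. -/
theorem exists_cube_of_separatesFaces {n m : ℕ} (hm : 0 < m) {a : Fin n → (Fin n → ℕ) → ZMod 2}
    (ha : SeparatesFaces m a) :
    ∃ x : Fin n → ℕ, ∀ l, ∃ y y' : Fin n → ℕ,
      (∀ i, x i ≤ y i ∧ y i ≤ x i + 1 ∧ y i ≤ m) ∧ (∀ i, x i ≤ y' i ∧ y' i ≤ x i + 1 ∧ y' i ≤ m) ∧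
      a l y = 0 ∧ a l y' = 1 := by
  have h1 : labelledPathSum m a ≠ 0 := by rw [labelledPathSum_eq_one hm ha]; exact one_ne_zero
  obtain ⟨x, hx, h2⟩ := Finset.exists_ne_zero_of_sum_ne_zero h1
  obtain ⟨π, -, h3⟩ := Finset.exists_ne_zero_of_sum_ne_zero h2
  simp only [Fintype.mem_piFinset, Finset.mem_range] at hx
  have hv : ∀ j i, x i ≤ latticePath x π j i ∧ latticePath x π j i ≤ x i + 1 ∧
      latticePath x π j i ≤ m := by
    intro j i
    have := hx i
    simp only [latticePath]
    split_ifs <;> omega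
  refine ⟨x, fun l => ?_⟩
  have h4 := Finset.prod_ne_zero_iff.1 h3 l (Finset.mem_univ l)
  have h5 : ∀ p q : ZMod 2, p + q ≠ 0 → (p = 0 ∧ q = 1) ∨ (q = 0 ∧ p = 1) := by decide
  rcases h5 _ _ h4 with h | h
  · exact ⟨_, _, hv _, hv _, h.1, h.2⟩
  · exact ⟨_, _, hv _, hv _, h.1, h.2⟩

/-! ### The Poincaré–Miranda theorem -/

/-- The Poincaré–Miranda theorem on the unit cube. -/
theorem poincare_miranda {n : ℕ} {r : (Fin n → ℝ) → Fin n → ℝ} (hr : Continuous r)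
    (h0 : ∀ x i, x i = 0 → r x i ≤ 0) (h1 : ∀ x i, x i = 1 → 0 ≤ r x i) :
    ∃ x ∈ Set.Icc (0 : Fin n → ℝ) 1, r x = 0 := by
  classical
  have step : ∀ m : ℕ, ∃ x : Fin n → ℝ, ∀ l, ∃ y y' : Fin n → ℝ,
      y ∈ Set.Icc (0 : Fin n → ℝ) 1 ∧ dist y x ≤ 1 / ((m : ℝ) + 1) ∧
      dist y' x ≤ 1 / ((m : ℝ) + 1) ∧ x ∈ Set.Icc (0 : Fin n → ℝ) 1 ∧
      r y l ≤ 0 ∧ 0 ≤ r y' l := by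
    intro m
    let sc : (Fin n → ℕ) → Fin n → ℝ := fun x i => (x i : ℝ) / ((m : ℝ) + 1)
    have hm : (0 : ℝ) < (m : ℝ) + 1 := by positivity
    -- The labels record the sign of `r` on a grid. They are prescribed on the faces because `r` may
    -- vanish there; the boundary hypotheses make the prescribed values consistent with the weak
    -- inequalities wanted at `y` and `y'`.
    let a : Fin n → (Fin n → ℕ) → ZMod 2 := fun l x =>
      if x l = 0 then 0 else if x l = m + 1 then 1 else if r (sc x) l ≤ 0 then 0 else 1
    have ha : SeparatesFaces (m + 1) a := fun l x =>
      ⟨fun h => by simp [a, h], fun h => by simp [a, h]⟩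
    obtain ⟨x, hx⟩ := exists_cube_of_separatesFaces m.succ_pos ha
    refine ⟨sc x, fun l => ?_⟩
    obtain ⟨y, y', hy, hy', hay, hay'⟩ := hx l
    have hd : ∀ y : Fin n → ℕ, (∀ i, x i ≤ y i ∧ y i ≤ x i + 1 ∧ y i ≤ m + 1) →
        dist (sc y) (sc x) ≤ 1 / ((m : ℝ) + 1) := by
      intro y hy
      refine (dist_pi_le_iff (by positivity)).2 fun i => ?_
      rw [Real.dist_eq, ← sub_div, abs_div, abs_of_pos hm]
      gcongr
      have h2 : (x i : ℝ) ≤ y i := by exact_mod_cast (hy i).1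
      have h3 : (y i : ℝ) ≤ x i + 1 := by exact_mod_cast (hy i).2.1
      rw [abs_le]; constructor <;> linarith
    have hI : ∀ y : Fin n → ℕ, (∀ i, y i ≤ m + 1) → sc y ∈ Set.Icc (0 : Fin n → ℝ) 1 := by
      intro y hy
      refine ⟨fun i => by simp only [sc, Pi.zero_apply]; positivity, fun i => ?_⟩
      simp only [sc, Pi.one_apply]
      rw [div_le_one hm]
      exact_mod_cast hy i
    refine ⟨sc y, sc y', hI y fun i => (hy i).2.2, hd y hy, hd y' hy',
      hI x fun i => (hy i).1.trans (hy i).2.2, ?_, ?_⟩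
    · simp only [a] at hay
      split_ifs at hay with h2 h3 h4
      · exact h0 _ _ (by simp [sc, h2])
      · exact absurd hay one_ne_zero
      · exact h4
      · exact absurd hay one_ne_zero
    · simp only [a] at hay'
      split_ifs at hay' with h2 h3 h4
      · exact absurd hay' zero_ne_one
      · exact h1 _ _ (by simp only [sc, h3]; push_cast; exact div_self hm.ne')
      · exact absurd hay' zero_ne_one
      · exact (not_le.1 h4).le
  -- Dimension `0` is separate, since `step` places the base point in the cube only by way of some
  -- coordinate `l`.
  rcases isEmpty_or_nonempty (Fin n) with he | ⟨⟨i0⟩⟩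
  · exact ⟨0, ⟨fun i => he.elim i, fun i => he.elim i⟩, funext fun i => he.elim i⟩
  choose p hp using step
  have hpI : ∀ m, p m ∈ Set.Icc (0 : Fin n → ℝ) 1 := fun m => by
    obtain ⟨_, _, h⟩ := hp m i0
    exact h.2.2.2.1
  obtain ⟨x, hx, φ, hφ, hlim⟩ := (isCompact_Icc (a := (0 : Fin n → ℝ)) (b := 1)).tendsto_subseq hpI
  refine ⟨x, hx, funext fun l => ?_⟩
  choose y y' hy using fun m => hp m l
  have hz : Tendsto (fun m => 1 / ((φ m : ℝ) + 1)) atTop (𝓝 0) :=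
    tendsto_one_div_add_atTop_nhds_zero_nat.comp hφ.tendsto_atTop
  -- All vertices of the shrinking cubes share the limit `x`, so both sign conditions pass to `r x
  -- l`.
  have hlimy : ∀ w : ℕ → Fin n → ℝ, (∀ m, dist (w m) (p m) ≤ 1 / ((m : ℝ) + 1)) →
      Tendsto (fun m => r (w (φ m)) l) atTop (𝓝 (r x l)) := by
    intro w hw
    have h2 : Tendsto (fun m => w (φ m)) atTop (𝓝 x) := by
      rw [tendsto_iff_dist_tendsto_zero] at hlim ⊢
      refine squeeze_zero (fun _ => dist_nonneg) (fun m => ?_) (by simpa only [add_zero] using hz.add hlim)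
      exact (dist_triangle _ (p (φ m)) _).trans (add_le_add (hw _) le_rfl)
    exact (((continuous_apply l).comp hr).tendsto x).comp h2
  exact le_antisymm
    (le_of_tendsto' (hlimy y fun m => (hy m).2.1) fun m => (hy (φ m)).2.2.2.2.1)
    (ge_of_tendsto' (hlimy y' fun m => (hy m).2.2.1) fun m => (hy (φ m)).2.2.2.2.2)

/-! ### Expectations in game trees -/

namespace GameTree

theorem chanceProb_nonneg {n : ℕ} {Info : Fin n → Type} {Act : (i : Fin n) → Info i → Type} :
    (Γ : GameTree Act) → (z : Γ.Terminal) → 0 ≤ Γ.chanceProb z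
  | .terminal _, _ => zero_le_one
  | @chance _ _ _ _ _ c child, z => mul_nonneg (c.2.1 z.1) (chanceProb_nonneg (child z.1) z.2)
  | .decision _ _ child, z => chanceProb_nonneg (child z.1) z.2

section

variable {n : ℕ} {Info : Fin n → Type} [∀ i, Fintype (Info i)] [∀ i, DecidableEq (Info i)]
  {Act : (i : Fin n) → Info i → Type} [∀ i I, Fintype (Act i I)] [∀ i I, DecidableEq (Act i I)]

theorem seqForm_nonneg (Γ : GameTree Act) {i : Fin n} (x : MixedStrategy Act i) (z : Γ.Terminal) :
    0 ≤ Γ.seqForm x z :=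
  Finset.sum_nonneg fun s _ => by
    split_ifs
    · exact x.2.1 s
    · exact le_rfl

theorem seqForm_of_sequence_eq_nil (Γ : GameTree Act) {i : Fin n} (x : MixedStrategy Act i)
    (z : Γ.Terminal) (h : Γ.sequence i z = []) : Γ.seqForm x z = 1 := by
  simp only [seqForm, h]
  simp

theorem hatProd_nonneg (Γ : GameTree Act) (x : Profile Act) (z : Γ.Terminal) :
    0 ≤ Γ.hatProd x z :=
  Finset.prod_nonneg fun i _ => Γ.seqForm_nonneg (x i) z

theorem expect_mono (Γ : GameTree Act) (x : Profile Act) {f g : Γ.Terminal → ℝ}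
    (h : ∀ z, f z ≤ g z) : Γ.expect x f ≤ Γ.expect x g :=
  Finset.sum_le_sum fun z _ => mul_le_mul_of_nonneg_left (h z)
    (mul_nonneg (Γ.chanceProb_nonneg z) (Γ.hatProd_nonneg x z))

theorem expect_add (Γ : GameTree Act) (x : Profile Act) (f g : Γ.Terminal → ℝ) :
    Γ.expect x (fun z => f z + g z) = Γ.expect x f + Γ.expect x g := by
  simp only [expect, mul_add, Finset.sum_add_distrib]

theorem expect_zero (Γ : GameTree Act) (x : Profile Act) : Γ.expect x (fun _ => 0) = 0 := by
  simp [expect]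

theorem expect_nonneg (Γ : GameTree Act) (x : Profile Act) {f : Γ.Terminal → ℝ}
    (h : ∀ z, 0 ≤ f z) : 0 ≤ Γ.expect x f :=
  (Γ.expect_zero x).symm.le.trans (Γ.expect_mono x h)

theorem expPayment_nonneg (Γ : GameTree Act) {P : ℝ} (q : Γ.Payments P) (i : Fin n)
    (x : Profile Act) : 0 ≤ Γ.expPayment q i x :=
  Γ.expect_nonneg x fun z => (q i z).2.1

theorem expect_terminal (u : Fin n → Set.Icc (0 : ℝ) 1) (x : Profile Act)
    (f : (terminal u : GameTree Act).Terminal → ℝ) : (terminal u).expect x f = f () := by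
  have h : ∀ z, (terminal u : GameTree Act).hatProd x z = 1 := fun z =>
    Finset.prod_eq_one fun i _ => seqForm_of_sequence_eq_nil _ _ _ rfl
  simp only [expect, h]
  exact (Fintype.sum_unique (ι := Unit) _).trans (by simp [chanceProb])

theorem expect_chance {K : Type} [Fintype K] (c : stdSimplex ℝ K) (child : K → GameTree Act)
    (x : Profile Act) (f : (chance c child).Terminal → ℝ) :
    (chance c child).expect x f = ∑ a, c a * (child a).expect x (fun z => f ⟨a, z⟩) := by
  refine (Fintype.sum_sigma (fun z : (a : K) × (child a).Terminal => _)).trans ?_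
  refine Finset.sum_congr rfl fun a _ => ?_
  rw [expect, Finset.mul_sum]
  refine Finset.sum_congr rfl fun z _ => ?_
  change c a * (child a).chanceProb z * (child a).hatProd x z * f ⟨a, z⟩ = _
  ring

/-- At the first decision node of a player on a path, the expectation splits over the actions. -/
theorem expect_decision (i : Fin n) (I : Info i) (child : Act i I → GameTree Act)
    (x : Profile Act) (f : (decision i I child).Terminal → ℝ)
    (hchild : ∀ a z, (child a).sequence i z = []) :
    (decision i I child).expect x f =
      ∑ a, (∑ s : PureStrategy Act i, if s I = a then x i s else 0) *
        (child a).expect x (fun z => f ⟨a, z⟩) := by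
  refine (Fintype.sum_sigma (fun z : (a : Act i I) × (child a).Terminal => _)).trans ?_
  refine Finset.sum_congr rfl fun a _ => ?_
  rw [expect, Finset.mul_sum]
  refine Finset.sum_congr rfl fun z _ => ?_
  have h : (decision i I child).hatProd x ⟨a, z⟩ =
      (∑ s : PureStrategy Act i, if s I = a then x i s else 0) * (child a).hatProd x z := by
    simp only [hatProd, ← Finset.mul_prod_erase _ _ (Finset.mem_univ i)]
    rw [seqForm_of_sequence_eq_nil _ _ _ (hchild a z), one_mul]
    congr 1
    · simp [seqForm, sequence, hchild a z]
    · refine Finset.prod_congr rfl fun j hj => ?_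
      have : i ≠ j := (Finset.ne_of_mem_erase hj).symm
      simp [seqForm, sequence, this]
  change (child a).chanceProb z * (decision i I child).hatProd x ⟨a, z⟩ * f ⟨a, z⟩ = _
  rw [h]
  ring

/-- The expectation is affine in the strategy of each player. -/
theorem expect_update (Γ : GameTree Act) (x : Profile Act) (i : Fin n) (y : MixedStrategy Act i)
    (f : Γ.Terminal → ℝ) :
    Γ.expect (Function.update x i y) f =
      ∑ s : PureStrategy Act i, y s *
        Γ.expect (Function.update x i ⟨Pi.single s 1, single_mem_stdSimplex ℝ s⟩) f := by
  simp only [expect, Finset.mul_sum]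
  rw [Finset.sum_comm]
  refine Finset.sum_congr rfl fun z _ => ?_
  have h : ∀ y : MixedStrategy Act i, Γ.hatProd (Function.update x i y) z =
      Γ.seqForm y z * ∏ j ∈ Finset.univ.erase i, Γ.seqForm (x j) z := by
    intro y
    rw [hatProd, ← Finset.mul_prod_erase _ _ (Finset.mem_univ i)]
    congr 1
    · simp
    · exact Finset.prod_congr rfl fun j hj => by simp [Finset.ne_of_mem_erase hj]
  have h2 : Γ.seqForm y z = ∑ s : PureStrategy Act i, y s *
      Γ.seqForm (⟨Pi.single s 1, single_mem_stdSimplex ℝ s⟩ : MixedStrategy Act i) z := by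
    refine Finset.sum_congr rfl fun s _ => ?_
    have : Γ.seqForm (⟨Pi.single s 1, single_mem_stdSimplex ℝ s⟩ : MixedStrategy Act i) z
        = if ∀ p ∈ Γ.sequence i z, s p.1 = p.2 then 1 else 0 := by
      rw [seqForm, Finset.sum_eq_single s]
      · split_ifs
        · exact Pi.single_eq_same (M := fun _ => ℝ) s 1
        · rfl
      · intro t _ ht
        split_ifs
        · exact Pi.single_eq_of_ne (M := fun _ => ℝ) ht 1
        · rfl
      · simp
    rw [this, mul_ite, mul_one, mul_zero]
  simp only [h]
  rw [h2, Finset.sum_mul, Finset.mul_sum, Finset.sum_mul]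
  refine Finset.sum_congr rfl fun s _ => ?_
  ring

theorem continuous_expect (Γ : GameTree Act) (f : Γ.Terminal → ℝ) {X : Type*} [TopologicalSpace X]
    {x : X → Profile Act} (hx : ∀ i s, Continuous fun w => x w i s) :
    Continuous fun w => Γ.expect (x w) f := by
  unfold expect hatProd seqForm
  refine continuous_finsetSum _ fun z _ => ?_
  refine (continuous_const.mul (continuous_finsetProd _ fun i _ => ?_)).mul continuous_const
  refine continuous_finsetSum _ fun s _ => ?_
  split_ifs
  · exact hx i s
  · exact continuous_const

end

end GameTree

/-! ### The stag hunt in terms of Stag probabilities -/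

theorem sum_stagHuntAction (f : StagHuntAction → ℝ) :
    ∑ a, f a = f StagHuntAction.stag + f StagHuntAction.hare := by
  change ∑ a ∈ {StagHuntAction.stag, StagHuntAction.hare}, f a = _
  simp

section StagHunt

open GameTree StagHuntAction

variable {n : ℕ}

theorem sum_pureStrategy {i : Fin n} (f : PureStrategy (StagHuntAct n) i → ℝ) :
    ∑ s, f s = f (fun _ => stag) + f (fun _ => hare) := by
  rw [← (Equiv.funUnique Unit StagHuntAction).symm.sum_comp f, sum_stagHuntAction]
  rfl

/-- The probability of Stag in a mixed strategy. -/
def stagProb {i : Fin n} (x : MixedStrategy (StagHuntAct n) i) : ℝ := x (fun _ => stag)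

theorem apply_hare {i : Fin n} (x : MixedStrategy (StagHuntAct n) i) :
    x (fun _ => hare) = 1 - stagProb x := by
  have h := x.2.2
  rw [sum_pureStrategy] at h
  exact eq_sub_of_add_eq' h

theorem stagProb_nonneg {i : Fin n} (x : MixedStrategy (StagHuntAct n) i) : 0 ≤ stagProb x :=
  x.2.1 _

theorem stagProb_le_one {i : Fin n} (x : MixedStrategy (StagHuntAct n) i) : stagProb x ≤ 1 := by
  have h := x.2.1 (fun _ => hare)
  have := apply_hare x
  change 0 ≤ x _ at h
  linarith

theorem mixedStrategy_ext {i : Fin n} {x y : MixedStrategy (StagHuntAct n) i}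
    (h : stagProb x = stagProb y) : x = y := by
  refine Subtype.ext (funext fun s => ?_)
  have hs : s = fun _ => s () := rfl
  rw [hs]
  cases s () with
  | stag => exact h
  | hare =>
    change x _ = y _
    rw [apply_hare, apply_hare, h]

/-- The mixed strategy that plays Stag with probability `p`. -/
noncomputable def stagWithProb (i : Fin n) (p : ℝ) (hp : p ∈ Set.Icc (0 : ℝ) 1) :
    MixedStrategy (StagHuntAct n) i :=
  ⟨fun s => match s () with
    | stag => p
    | hare => 1 - p,
   fun s => by
    cases h : s () <;> simp only [h]
    · exact hp.1
    · linarith [hp.2],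
   by rw [sum_pureStrategy]; simp⟩

theorem stagProb_allStag (i : Fin n) : stagProb (allStag n i) = 1 :=
  Pi.single_eq_same (M := fun _ : PureStrategy (StagHuntAct n) i => ℝ) (fun _ => stag) 1

theorem expect_decision_stagHunt (i : Fin n) (child : StagHuntAction → GameTree (StagHuntAct n))
    (x : Profile (StagHuntAct n)) (f : (decision (Act := StagHuntAct n) i () child).Terminal → ℝ)
    (hchild : ∀ a z, (child a).sequence i z = []) :
    (decision (Act := StagHuntAct n) i () child).expect x f =
      stagProb (x i) * (child stag).expect x (fun z => f ⟨stag, z⟩)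
      + (1 - stagProb (x i)) * (child hare).expect x (fun z => f ⟨hare, z⟩) := by
  rw [expect_decision i () child x f hchild]
  refine (sum_stagHuntAction _).trans ?_
  rw [sum_pureStrategy, sum_pureStrategy, ← apply_hare]
  simp [stagProb]

theorem sequence_stagHuntChain {i : Fin n} : (l : List (Fin n)) → i ∉ l →
    ∀ z, (stagHuntChain l).sequence i z = []
  | [], _, _ => rfl
  | j :: l, h, ⟨stag, z⟩ =>
    (dif_neg fun e : j = i => h (e ▸ List.mem_cons_self)).trans
      (sequence_stagHuntChain l (fun e => h (List.mem_cons_of_mem _ e)) z)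
  | j :: _, h, ⟨hare, _⟩ => dif_neg fun e : j = i => h (e ▸ List.mem_cons_self)

theorem expect_stagHuntChain_cons {i : Fin n} {l : List (Fin n)} (hi : i ∉ l)
    (x : Profile (StagHuntAct n)) (f : (stagHuntChain (i :: l)).Terminal → ℝ) :
    (stagHuntChain (i :: l)).expect x f =
      stagProb (x i) * (stagHuntChain l).expect x (fun z => f ⟨stag, z⟩)
      + (1 - stagProb (x i)) * f ⟨hare, ()⟩ := by
  refine (expect_decision_stagHunt i _ x f ?_).trans ?_
  · rintro (_ | _) z
    · exact sequence_stagHuntChain l hi z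
    · rfl
  · congr 2
    exact expect_terminal (Act := StagHuntAct n) _ x _

theorem expect_stagHuntChain_utility (i : Fin n) (x : Profile (StagHuntAct n)) :
    ∀ l : List (Fin n), l.Nodup →
      (stagHuntChain l).expect x ((stagHuntChain l).utility i) = (l.map fun j => stagProb (x j)).prod
  | [], _ => by
    refine (expect_terminal (Act := StagHuntAct n) _ x _).trans ?_
    simp only [List.map_nil, List.prod_nil]
    rfl
  | j :: l, h => by
    rw [List.nodup_cons] at h
    rw [expect_stagHuntChain_cons h.1, List.map_cons, List.prod_cons,
      ← expect_stagHuntChain_utility i x l h.2]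
    have : (stagHuntChain (j :: l)).utility i ⟨hare, ()⟩ = 0 := rfl
    rw [this, mul_zero, add_zero]
    rfl

theorem expect_stagHuntChain_le {P : ℝ} (x : Profile (StagHuntAct n)) :
    ∀ l : List (Fin n), l.Nodup → ∀ f : (stagHuntChain l).Terminal → ℝ, (∀ z, f z ≤ P) →
      (stagHuntChain l).expect x f ≤ P
  | [], _, f, hf => (expect_terminal (Act := StagHuntAct n) _ x f).trans_le (hf _)
  | j :: l, h, f, hf => by
    rw [List.nodup_cons] at h
    rw [expect_stagHuntChain_cons h.1]
    have h1 := expect_stagHuntChain_le x l h.2 (fun z => f ⟨stag, z⟩) (fun z => hf _)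
    have h2 := hf ⟨hare, ()⟩
    nlinarith [stagProb_nonneg (x j), stagProb_le_one (x j)]

/-- If the first player surely plays Hare, the chain ends at once and nobody else's strategy
matters. -/
theorem expect_stagHuntChain_congr {x y : Profile (StagHuntAct n)} {k : Fin n}
    {l : List (Fin n)} (hl : (k :: l).Nodup) (hx : stagProb (x k) = 0) (hy : stagProb (y k) = 0)
    (f : (stagHuntChain (k :: l)).Terminal → ℝ) :
    (stagHuntChain (k :: l)).expect x f = (stagHuntChain (k :: l)).expect y f := by
  rw [List.nodup_cons] at hl
  rw [expect_stagHuntChain_cons hl.1, expect_stagHuntChain_cons hl.1, hx, hy]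
  simp

theorem rotate_finRange_eq_cons (k : Fin n) :
    ∃ l, (List.finRange n).rotate k = k :: l := by
  refine ⟨(List.finRange n).drop (k + 1) ++ (List.finRange n).take k, ?_⟩
  rw [List.rotate_eq_drop_append_take (by simp [k.2.le]),
    List.drop_eq_getElem_cons (by simp)]
  simp

theorem nodup_rotate_finRange (k : ℕ) : ((List.finRange n).rotate k).Nodup :=
  List.nodup_rotate.2 (List.nodup_finRange n)

variable [NeZero n]

/-- The terminal node at which chance picks player `j`, who plays `a`. -/
def soloTerminal (j : Fin n) (a : StagHuntAction) : (stagHunt n).Terminal :=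
  ⟨some j, match a with
    | stag => ⟨stag, ()⟩
    | hare => ⟨hare, ()⟩⟩

/-- The terminal node of the cooperative part with starting player `k`. -/
def chainTerminal (k : Fin n) (z : (stagHuntChain ((List.finRange n).rotate k)).Terminal) :
    (stagHunt n).Terminal :=
  ⟨none, ⟨k, z⟩⟩

theorem expect_stagHunt (x : Profile (StagHuntAct n)) (f : (stagHunt n).Terminal → ℝ) :
    (stagHunt n).expect x f = 1 / ((n : ℝ) + 1) *
      (∑ j, (stagProb (x j) * f (soloTerminal j stag)
          + (1 - stagProb (x j)) * f (soloTerminal j hare))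
        + 1 / (n : ℝ) * ∑ k : Fin n, (stagHuntChain ((List.finRange n).rotate k)).expect x
            (fun z => f (chainTerminal k z))) := by
  refine (expect_chance (Act := StagHuntAct n) _ _ x f).trans ?_
  have hu : ∀ (K : Type) [Fintype K] [Nonempty K] (a : K),
      (uniformDist K) a = 1 / (Fintype.card K : ℝ) := fun _ _ _ _ => rfl
  simp only [hu, Fintype.card_option, Fintype.card_fin, ← Finset.mul_sum, Fintype.sum_option]
  push_cast
  congr 1
  rw [add_comm]
  congr 1
  · refine Finset.sum_congr rfl fun j _ => ?_
    refine (expect_decision_stagHunt j _ x _ ?_).trans ?_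
    · rintro (_ | _) z <;> rfl
    · congr 2
      · exact expect_terminal (Act := StagHuntAct n) _ x _
      · exact expect_terminal (Act := StagHuntAct n) _ x _
  · refine (expect_chance (Act := StagHuntAct n) _ _ x _).trans ?_
    simp only [hu, Fintype.card_fin, ← Finset.mul_sum]
    rfl

theorem expUtility_stagHunt (i : Fin n) (x : Profile (StagHuntAct n)) :
    (stagHunt n).expUtility i x =
      1 / ((n : ℝ) + 1) * ((1 - stagProb (x i)) / 2 + ∏ j, stagProb (x j)) := by
  rw [expUtility, expect_stagHunt]
  congr 2
  · rw [Finset.sum_eq_single i]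
    · have h1 : (stagHunt n).utility i (soloTerminal i stag) = 0 := rfl
      have h2 : (stagHunt n).utility i (soloTerminal i hare) = 1 / 2 := by
        change ((if i = i then _ else _ : Set.Icc (0 : ℝ) 1) : ℝ) = _
        rw [if_pos rfl]
      rw [h1, h2]; ring
    · intro j _ hj
      have h1 : (stagHunt n).utility i (soloTerminal j stag) = 0 := rfl
      have h2 : (stagHunt n).utility i (soloTerminal j hare) = 0 := by
        change ((if i = j then _ else _ : Set.Icc (0 : ℝ) 1) : ℝ) = _
        rw [if_neg hj.symm]; rfl
      rw [h1, h2]; ring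
    · simp
  · have h : ∀ k : Fin n, (stagHuntChain ((List.finRange n).rotate k)).expect x
        (fun z => (stagHunt n).utility i (chainTerminal k z)) = ∏ j, stagProb (x j) := by
      intro k
      refine (expect_stagHuntChain_utility i x _ (nodup_rotate_finRange k)).trans ?_
      rw [((List.rotate_perm (List.finRange n) (k : ℕ)).map _).prod_eq, ← List.ofFn_eq_map,
        List.prod_ofFn]
    simp only [h]
    have hn : (n : ℝ) ≠ 0 := by exact_mod_cast NeZero.ne n
    simp
    field_simp

theorem welfare_stagHunt (x : Profile (StagHuntAct n)) :
    (stagHunt n).welfare x =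
      1 / ((n : ℝ) + 1) * (∑ i, (1 - stagProb (x i)) / 2 + n * ∏ j, stagProb (x j)) := by
  simp only [welfare, expUtility_stagHunt, ← Finset.mul_sum, Finset.sum_add_distrib]
  simp

theorem welfare_allStag : (stagHunt n).welfare (allStag n) = 1 / ((n : ℝ) + 1) * n := by
  simp [welfare_stagHunt, stagProb_allStag]

/-- Let `p` be the smallest Stag probability. The solo branches give at most `n(1 - p)/2` and the
cooperative branch at most `np`, so that `n(1 - p)/2` is missing from `n`; and `1 - p` is at least
`1 - stagProb (x i)`. -/
theorem le_welfareGap (x : Profile (StagHuntAct n)) (i : Fin n) :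
    1 / ((n : ℝ) + 1) * (n / 2 * (1 - stagProb (x i))) ≤
      (stagHunt n).welfare (allStag n) - (stagHunt n).welfare x := by
  rw [welfare_allStag, welfare_stagHunt, ← mul_sub]
  refine mul_le_mul_of_nonneg_left ?_ (by positivity)
  obtain ⟨k, -, hk⟩ := Finset.exists_min_image Finset.univ (fun j => stagProb (x j))
    ⟨i, Finset.mem_univ i⟩
  have h1 : ∑ j, (1 - stagProb (x j)) / 2 ≤ n * ((1 - stagProb (x k)) / 2) := by
    have := Finset.sum_le_card_nsmul Finset.univ (fun j => (1 - stagProb (x j)) / 2)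
      ((1 - stagProb (x k)) / 2) (fun j hj => by have := hk j hj; linarith)
    simpa using this
  have h2 : ∏ j, stagProb (x j) ≤ stagProb (x k) := by
    rw [← Finset.mul_prod_erase _ _ (Finset.mem_univ k)]
    exact mul_le_of_le_one_right (stagProb_nonneg _)
      (Finset.prod_le_one (fun _ _ => stagProb_nonneg _) fun _ _ => stagProb_le_one _)
  have h3 := hk i (Finset.mem_univ i)
  have hn : (0 : ℝ) ≤ n := by positivity
  nlinarith

theorem welfare_lt_welfare_allStag {x : Profile (StagHuntAct n)} (hx : x ≠ allStag n) :
    (stagHunt n).welfare x < (stagHunt n).welfare (allStag n) := by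
  obtain ⟨i, hi⟩ : ∃ i, stagProb (x i) < 1 := by
    by_contra! h
    exact hx (funext fun i => mixedStrategy_ext
      ((le_antisymm (stagProb_le_one _) (h i)).trans (stagProb_allStag i).symm))
  have hn : (0 : ℝ) < n := by exact_mod_cast Nat.pos_of_ne_zero (NeZero.ne n)
  have h1 : 0 < 1 / ((n : ℝ) + 1) * (n / 2 * (1 - stagProb (x i))) := by
    have : 0 < 1 - stagProb (x i) := by linarith
    positivity
  linarith [le_welfareGap x i]

theorem isNash_allStag : (stagHunt n).IsNash (allStag n) := by
  intro i y
  rw [expUtility_stagHunt, expUtility_stagHunt]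
  refine mul_le_mul_of_nonneg_left ?_ (by positivity)
  rw [← Finset.mul_prod_erase _ _ (Finset.mem_univ i),
    Finset.prod_eq_one (s := Finset.univ.erase i) fun j hj => by
      rw [Function.update_of_ne (Finset.ne_of_mem_erase hj), stagProb_allStag]]
  simp only [Function.update_self, stagProb_allStag, Finset.prod_const_one]
  linarith [stagProb_le_one y]

theorem numNodes_stagHunt : (stagHunt n).numNodes = 2 * (n + 1) ^ 2 := by
  have hchain : ∀ l : List (Fin n), (stagHuntChain l).numNodes = 2 * l.length + 1 := by
    intro l
    induction l with
    | nil => rfl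
    | cons j l ih =>
      change 1 + ((stagHuntChain l).numNodes + (1 + 0)) = _
      rw [ih, List.length_cons]
      ring
  change 1 + ∑ j : Option (Fin n), _ = _
  rw [Fintype.sum_option]
  change 1 + ((1 + ∑ k : Fin n, (stagHuntChain ((List.finRange n).rotate k)).numNodes)
    + ∑ j : Fin n, 3) = _
  simp [hchain]
  ring

theorem perfectRecall_stagHunt : (stagHunt n).PerfectRecall := by
  have hterm : ∀ (i : Fin n) u σ, ¬ HasNode (Act := StagHuntAct n) i () (terminal u) σ := by
    intro i u σ h
    cases h
  have hmem : ∀ (i : Fin n) (l : List (Fin n)) σ, HasNode i () (stagHuntChain l) σ → i ∈ l := by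
    intro i l
    induction l with
    | nil => intro σ h; exact (hterm _ _ _ h).elim
    | cons j l ih =>
      intro σ h
      rw [stagHuntChain] at h
      cases h with
      | here => simp
      | own J child a σ h => simp
      | other j hj J child a σ h =>
        cases a with
        | stag => exact List.mem_cons_of_mem _ (ih _ h)
        | hare => exact (hterm _ _ _ h).elim
  have hnil : ∀ (i : Fin n) (l : List (Fin n)) σ, l.Nodup → HasNode i () (stagHuntChain l) σ →
      σ = [] := by
    intro i l
    induction l with
    | nil => intro σ _ h; exact (hterm _ _ _ h).elim
    | cons j l ih =>
      intro σ hl h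
      rw [List.nodup_cons] at hl
      rw [stagHuntChain] at h
      cases h with
      | here => rfl
      | own J child a σ h =>
        cases a with
        | stag => exact (hl.1 (hmem _ _ _ h)).elim
        | hare => exact (hterm _ _ _ h).elim
      | other j hj J child a σ h =>
        cases a with
        | stag => exact ih _ hl.2 h
        | hare => exact (hterm _ _ _ h).elim
  -- No player moves twice on a path, so the player's own earlier sequence is empty at each of their
  -- nodes.
  have key : ∀ (i : Fin n) σ, HasNode i () (stagHunt n) σ → σ = [] := by
    intro i σ h
    rw [stagHunt] at h
    cases h with
    | chance c child a σ h =>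
      cases a with
      | none =>
        cases h with
        | chance c child k σ h => exact hnil _ _ _ (nodup_rotate_finRange k) h
      | some j =>
        cases h with
        | here => rfl
        | own J child a σ h => cases a <;> exact (hterm _ _ _ h).elim
        | other j hj J child a σ h => cases a <;> exact (hterm _ _ _ h).elim
  intro i I σ σ' h h'
  rw [key i σ h, key i σ' h']

end StagHunt

/-! ### Regret and steering in general games -/

namespace GameTree

variable {n : ℕ} {Info : Fin n → Type} [∀ i, Fintype (Info i)] [∀ i, DecidableEq (Info i)]
  {Act : (i : Fin n) → Info i → Type} [∀ i I, Fintype (Act i I)] [∀ i I, DecidableEq (Act i I)]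

theorem expUtility_add_expPayment (Γ : GameTree Act) {P : ℝ} (q : Γ.Payments P) (i : Fin n)
    (x : Profile Act) : Γ.expUtility i x + Γ.expPayment q i x =
      Γ.expect x (fun z => Γ.utility i z + q i z) :=
  (Γ.expect_add x _ _).symm

/-- Playing an equilibrium of the game with payments in every round gives non-positive regret. -/
theorem regret_nonpos (Γ : GameTree Act) {P : ℝ} (hP : 0 < P) {q : ℕ → Γ.Payments P}
    {x : ℕ → Profile Act} {i : Fin n}
    (h : ∀ t (y : MixedStrategy Act i), Γ.expUtility i (Function.update (x t) i y)
        + Γ.expPayment (q t) i (Function.update (x t) i y) ≤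
      Γ.expUtility i (x t) + Γ.expPayment (q t) i (x t)) (T : ℕ) :
    Γ.regret q x T i ≤ 0 := by
  refine mul_nonpos_of_nonneg_of_nonpos (by positivity) (sub_nonpos.2 ?_)
  have : Nonempty (MixedStrategy Act i) := ⟨x 0 i⟩
  exact ciSup_le fun y => Finset.sum_le_sum fun t _ => h t y

/-- The welfare is a linear function of `hatProd` with coefficients that depend only on the game, so
it is Lipschitz for the `ℓ¹`-distance that defines the directness gap. -/
theorem exists_avgWelfareGap_le (Γ : GameTree Act) (d : Profile Act) :
    ∃ C, ∀ (x : ℕ → Profile Act) T, Γ.avgWelfareGap d x T ≤ C * Γ.directnessGap d x T := by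
  let w : Γ.Terminal → ℝ := fun z => Γ.chanceProb z * ∑ i, Γ.utility i z
  have hw : ∀ x, Γ.welfare x = ∑ z, w z * Γ.hatProd x z := by
    intro x
    simp only [welfare, expUtility, expect]
    rw [Finset.sum_comm]
    refine Finset.sum_congr rfl fun z _ => ?_
    rw [← Finset.mul_sum]
    ring
  refine ⟨∑ z, |w z|, fun x T => ?_⟩
  have h1 : Γ.avgWelfareGap d x T =
      ∑ z, w z * (Γ.hatProd d z - 1 / (T : ℝ) * ∑ t ∈ Finset.range T, Γ.hatProd (x t) z) := by
    simp only [avgWelfareGap, hw]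
    rw [Finset.sum_comm, Finset.mul_sum, ← Finset.sum_sub_distrib]
    refine Finset.sum_congr rfl fun z _ => ?_
    rw [← Finset.mul_sum]
    ring
  rw [h1, Finset.sum_mul]
  refine Finset.sum_le_sum fun z _ => (le_abs_self _).trans ?_
  rw [abs_mul, abs_sub_comm]
  exact mul_le_mul_of_nonneg_left
    (Finset.single_le_sum (f := fun z => |1 / (T : ℝ) * (∑ t ∈ Finset.range T, Γ.hatProd (x t) z)
      - Γ.hatProd d z|) (fun _ _ => abs_nonneg _) (Finset.mem_univ z)) (abs_nonneg _)

/-- Steering is impossible if the welfare gap or the total payment stays away from `0`. -/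
theorem not_steered_of_le (Γ : GameTree Act) (d : Profile Act) {P : ℝ}
    (q : ℕ → ℕ → Γ.Payments P) (x : ℕ → ℕ → Profile Act) {ε : ℝ} (hε : 0 < ε)
    (h : ∀ T, 0 < T → ε ≤ Γ.avgWelfareGap d (x T) T ∨
      ε ≤ ∑ i, Γ.avgPayment (q T) (x T) T i) : ¬ Γ.Steered d q x := by
  rintro ⟨hp, hd⟩
  obtain ⟨C, hC⟩ := Γ.exists_avgWelfareGap_le d
  have hp' := hp.const_mul (n : ℝ)
  have hd' := hd.const_mul C
  rw [mul_zero] at hp' hd'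
  obtain ⟨T, hT1, hT2, hT3⟩ := ((hp'.eventually_lt_const hε).and
    ((hd'.eventually_lt_const hε).and (eventually_gt_atTop 0))).exists
  rcases h T hT3 with h1 | h1
  · linarith [hC (x T) T]
  · have h2 : ∑ i, Γ.avgPayment (q T) (x T) T i ≤ n * ⨆ i, Γ.avgPayment (q T) (x T) T i := by
      have := Finset.sum_le_card_nsmul Finset.univ (fun i => Γ.avgPayment (q T) (x T) T i)
        (⨆ i, Γ.avgPayment (q T) (x T) T i) (fun i _ => le_ciSup (Set.finite_range _).bddAbove i)
      simpa using this
    linarith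

end GameTree

/-! ### Equilibria of the stag hunt with payments -/

section StagHunt

open GameTree StagHuntAction

variable {n : ℕ}

/-- The expected gain of player `i` from playing Stag instead of Hare. -/
noncomputable def stagGain (Γ : GameTree (StagHuntAct n)) (f : Γ.Terminal → ℝ) (i : Fin n)
    (x : Profile (StagHuntAct n)) : ℝ :=
  Γ.expect (Function.update x i ⟨Pi.single (fun _ => stag) 1, single_mem_stdSimplex ℝ _⟩) f
    - Γ.expect (Function.update x i ⟨Pi.single (fun _ => hare) 1, single_mem_stdSimplex ℝ _⟩) f

/-- The expectation is affine in a player's own Stag probability, with slope `stagGain`; the sign of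
the slope decides the best response. -/
theorem expect_update_sub (Γ : GameTree (StagHuntAct n)) (f : Γ.Terminal → ℝ) (i : Fin n)
    (x : Profile (StagHuntAct n)) (y : MixedStrategy (StagHuntAct n) i) :
    Γ.expect (Function.update x i y) f - Γ.expect x f =
      (stagProb y - stagProb (x i)) * stagGain Γ f i x := by
  have h := Γ.expect_update x i (x i) f
  rw [Function.update_eq_self] at h
  rw [h, Γ.expect_update x i y f, sum_pureStrategy, sum_pureStrategy, apply_hare, apply_hare,
    stagGain]
  change stagProb y * _ + _ - (stagProb (x i) * _ + _) = _
  ring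

/-- Nash's theorem for games in which every player has one information set and two actions. -/
theorem exists_equilibrium (Γ : GameTree (StagHuntAct n)) (f : Fin n → Γ.Terminal → ℝ) :
    ∃ x : Profile (StagHuntAct n), ∀ (i : Fin n) (y : MixedStrategy (StagHuntAct n) i),
      Γ.expect (Function.update x i y) (f i) ≤ Γ.expect x (f i) := by
  have hcl : ∀ s : ℝ, max 0 (min 1 s) ∈ Set.Icc (0 : ℝ) 1 := fun s =>
    ⟨le_max_left _ _, max_le zero_le_one (min_le_left _ _)⟩
  -- Clamping to `[0, 1]` defines the profile on all of `ℝⁿ`, where `poincare_miranda` asks for a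
  -- continuous function.
  let X : (Fin n → ℝ) → Profile (StagHuntAct n) := fun s i =>
    stagWithProb i (max 0 (min 1 (s i))) (hcl _)
  have hX : ∀ i (σ : PureStrategy (StagHuntAct n) i), Continuous fun s => X s i σ := by
    intro i σ
    have hc : Continuous fun s : Fin n → ℝ => max 0 (min 1 (s i)) := by fun_prop
    have hσ : σ = fun _ => σ () := rfl
    rw [hσ]
    cases σ () with
    | stag => exact hc
    | hare => exact continuous_const.sub hc
  have hgain : ∀ i, Continuous fun s => stagGain Γ (f i) i (X s) := by
    intro i
    have hupd : ∀ y : MixedStrategy (StagHuntAct n) i, ∀ j (σ : PureStrategy (StagHuntAct n) j),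
        Continuous fun s => Function.update (X s) i y j σ := by
      intro y j σ
      by_cases hj : j = i
      · subst hj; simp only [Function.update_self]; exact continuous_const
      · simp only [Function.update_of_ne hj]; exact hX j σ
    exact (Γ.continuous_expect _ (hupd _)).sub (Γ.continuous_expect _ (hupd _))
  -- A zero is a fixed point of the map that moves each Stag probability by its gain and clamps the
  -- result. The boundary signs hold because clamped values lie in `[0, 1]`.
  obtain ⟨s, hs, hr⟩ := poincare_miranda
    (r := fun s i => s i - max 0 (min 1 (s i + stagGain Γ (f i) i (X s))))
    (continuous_pi fun i => (continuous_apply i).sub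
      (continuous_const.max (continuous_const.min ((continuous_apply i).add (hgain i)))))
    (fun s i h => by simp [h]) (fun s i h => by simp [h])
  refine ⟨X s, fun i y => sub_nonpos.1 ?_⟩
  rw [expect_update_sub]
  have h0 : 0 ≤ s i := hs.1 i
  have h1 : s i ≤ 1 := hs.2 i
  have hXs : stagProb (X s i) = s i := by
    change max 0 (min 1 (s i)) = s i
    rw [min_eq_right h1, max_eq_right h0]
  have hri : s i = max 0 (min 1 (s i + stagGain Γ (f i) i (X s))) := sub_eq_zero.1 (congrFun hr i)
  rw [hXs]
  have hy0 := stagProb_nonneg y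
  have hy1 := stagProb_le_one y
  generalize stagGain Γ (f i) i (X s) = g at hri ⊢
  -- At a fixed point a negative gain forces probability `0` and a positive gain forces `1`; with
  -- zero gain the player is indifferent.
  rcases lt_trichotomy g 0 with hg | hg | hg
  · have : s i = 0 := by
      by_contra hne
      have hpos : 0 < s i := lt_of_le_of_ne h0 (Ne.symm hne)
      have : max 0 (min 1 (s i + g)) < s i :=
        max_lt hpos ((min_le_right _ _).trans_lt (by linarith))
      linarith
    rw [this]
    nlinarith
  · simp [hg]
  · have : s i = 1 := by
      by_contra hne
      have hlt : s i < 1 := lt_of_le_of_ne h1 hne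
      have : s i < max 0 (min 1 (s i + g)) := lt_max_of_lt_right (lt_min hlt (by linarith))
      linarith
    rw [this]
    nlinarith

variable (n) in
/-- The profile in which everyone plays Hare. -/
noncomputable def allHare : Profile (StagHuntAct n) :=
  fun i => stagWithProb i 0 ⟨le_rfl, zero_le_one⟩

theorem stagProb_allHare (i : Fin n) : stagProb (allHare n i) = 0 := rfl

variable [NeZero n]

theorem le_expPayment {P : ℝ} (q : (stagHunt n).Payments P) (i : Fin n)
    (x : Profile (StagHuntAct n)) :
    1 / ((n : ℝ) + 1) * (stagProb (x i) * q i (soloTerminal i stag)) ≤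
      (stagHunt n).expPayment q i x := by
  have hterm : ∀ j, 0 ≤ stagProb (x j) * (q i (soloTerminal j stag) : ℝ) := fun j =>
    mul_nonneg (stagProb_nonneg _) (q i _).2.1
  have hterm' : ∀ j, 0 ≤ (1 - stagProb (x j)) * (q i (soloTerminal j hare) : ℝ) := fun j =>
    mul_nonneg (sub_nonneg.2 (stagProb_le_one _)) (q i _).2.1
  rw [expPayment, expect_stagHunt]
  refine mul_le_mul_of_nonneg_left ?_ (by positivity)
  have h1 : stagProb (x i) * (q i (soloTerminal i stag) : ℝ) ≤
      ∑ j, (stagProb (x j) * (q i (soloTerminal j stag) : ℝ)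
        + (1 - stagProb (x j)) * (q i (soloTerminal j hare) : ℝ)) :=
    (le_add_of_nonneg_right (hterm' i)).trans
      (Finset.single_le_sum (f := fun j => stagProb (x j) * (q i (soloTerminal j stag) : ℝ)
        + (1 - stagProb (x j)) * (q i (soloTerminal j hare) : ℝ))
        (fun j _ => add_nonneg (hterm j) (hterm' j)) (Finset.mem_univ i))
  have h2 : 0 ≤ 1 / (n : ℝ) * ∑ k : Fin n, (stagHuntChain ((List.finRange n).rotate k)).expect x
      (fun z => (q i (chainTerminal k z) : ℝ)) :=
    mul_nonneg (by positivity)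
      (Finset.sum_nonneg fun k _ => expect_nonneg _ _ fun z => (q i _).2.1)
  linarith

/-- While all others play Hare, a deviation of `i` can change the terminal node only in the solo
branch of `i` and in the chain that starts with `i`. The latter has probability `1/n` within the
cooperative branch, hence the term `P / n`. -/
theorem expPayment_update_allHare_le {P : ℝ} (q : (stagHunt n).Payments P) (i : Fin n)
    (y : MixedStrategy (StagHuntAct n) i) :
    (stagHunt n).expPayment q i (Function.update (allHare n) i y) ≤
      (stagHunt n).expPayment q i (allHare n)
        + 1 / ((n : ℝ) + 1) * (stagProb y * (q i (soloTerminal i stag) + P / n)) := by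
  have hy0 := stagProb_nonneg y
  set x' := Function.update (allHare n) i y with hx'
  have hi : stagProb (x' i) = stagProb y := by simp [hx']
  have hne : ∀ j, j ≠ i → stagProb (x' j) = stagProb (allHare n j) := by
    intro j hj
    rw [hx', Function.update_of_ne hj]
  rw [expPayment, expPayment, expect_stagHunt, expect_stagHunt, ← mul_add]
  refine mul_le_mul_of_nonneg_left ?_ (by positivity)
  have h1 : ∑ j, (stagProb (x' j) * (q i (soloTerminal j stag) : ℝ)
        + (1 - stagProb (x' j)) * (q i (soloTerminal j hare) : ℝ)) ≤
      ∑ j, (stagProb (allHare n j) * (q i (soloTerminal j stag) : ℝ)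
        + (1 - stagProb (allHare n j)) * (q i (soloTerminal j hare) : ℝ))
        + stagProb y * (q i (soloTerminal i stag) : ℝ) := by
    rw [← Finset.add_sum_erase _ _ (Finset.mem_univ i),
      ← Finset.add_sum_erase (a := i) Finset.univ (fun j => stagProb (allHare n j) * _ + _)
        (Finset.mem_univ i)]
    rw [Finset.sum_congr rfl fun j hj => by
      rw [hne j (Finset.ne_of_mem_erase hj)]]
    rw [hi, stagProb_allHare]
    nlinarith [(q i (soloTerminal i hare)).2.1]
  have h2 : ∑ k : Fin n, (stagHuntChain ((List.finRange n).rotate k)).expect x'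
        (fun z => (q i (chainTerminal k z) : ℝ)) ≤
      ∑ k : Fin n, (stagHuntChain ((List.finRange n).rotate k)).expect (allHare n)
        (fun z => (q i (chainTerminal k z) : ℝ)) + stagProb y * P := by
    rw [← Finset.add_sum_erase _ _ (Finset.mem_univ i),
      ← Finset.add_sum_erase (a := i) Finset.univ
        (fun k : Fin n => (stagHuntChain ((List.finRange n).rotate k)).expect (allHare n) _)
        (Finset.mem_univ i)]
    -- The type of the terminal nodes depends on the rotated list, so the list is generalized before
    -- it is split into its head and tail.
    have hgen : ∀ (l : List (Fin n)) (k : Fin n), l.Nodup → (∃ l', l = k :: l') →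
        ∀ f : (stagHuntChain l).Terminal → ℝ, (∀ z, 0 ≤ f z ∧ f z ≤ P) →
        (k ≠ i → (stagHuntChain l).expect x' f = (stagHuntChain l).expect (allHare n) f) ∧
        (k = i → (stagHuntChain l).expect x' f ≤
          (stagHuntChain l).expect (allHare n) f + stagProb y * P) := by
      rintro _ k hl ⟨l', rfl⟩ f hf
      refine ⟨fun hk => expect_stagHuntChain_congr hl ((hne k hk).trans (stagProb_allHare k))
        (stagProb_allHare k) f, ?_⟩
      rintro rfl
      rw [List.nodup_cons] at hl
      rw [expect_stagHuntChain_cons hl.1, expect_stagHuntChain_cons hl.1, hi, stagProb_allHare]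
      have h3 := expect_stagHuntChain_le x' l' hl.2 (fun z => f ⟨stag, z⟩) (fun z => (hf _).2)
      have h4 := (hf ⟨hare, ()⟩).1
      nlinarith
    have hgen' := fun k : Fin n => hgen _ k (nodup_rotate_finRange k) (rotate_finRange_eq_cons k)
      (fun z => (q i (chainTerminal k z) : ℝ)) (fun z => (q i _).2)
    rw [Finset.sum_congr rfl fun j hj => (hgen' j).1 (Finset.ne_of_mem_erase hj)]
    linarith [(hgen' i).2 rfl]
  have hn : (0 : ℝ) < n := by exact_mod_cast Nat.pos_of_ne_zero (NeZero.ne n)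
  have h3 := mul_le_mul_of_nonneg_left h2 (by positivity : 0 ≤ 1 / (n : ℝ))
  have h4 : 1 / (n : ℝ) * (stagProb y * P) = stagProb y * (P / n) := by ring
  rw [mul_add, h4] at h3
  linarith

theorem expUtility_update_allHare (hn : 2 ≤ n) (i : Fin n)
    (y : MixedStrategy (StagHuntAct n) i) :
    (stagHunt n).expUtility i (Function.update (allHare n) i y) =
      (stagHunt n).expUtility i (allHare n) - 1 / ((n : ℝ) + 1) * (stagProb y / 2) := by
  have : Nontrivial (Fin n) := Fin.nontrivial_iff_two_le.2 hn
  obtain ⟨j, hj⟩ := exists_ne i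
  rw [expUtility_stagHunt, expUtility_stagHunt,
    Finset.prod_eq_zero (Finset.mem_univ j) (by rw [Function.update_of_ne hj, stagProb_allHare]),
    Finset.prod_eq_zero (Finset.mem_univ j) (stagProb_allHare j), Function.update_self,
    stagProb_allHare]
  ring

/-- For all payment functions, the game with payments has an equilibrium in which some player is
either likely to play Hare or receives a large payment. -/
theorem exists_bad_equilibrium {P : ℝ} (hn : 2 ≤ n) (hPn : 8 * P ≤ n)
    (q : (stagHunt n).Payments P) :
    ∃ x : Profile (StagHuntAct n),
      (∀ (i : Fin n) (y : MixedStrategy (StagHuntAct n) i),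
        (stagHunt n).expUtility i (Function.update x i y)
            + (stagHunt n).expPayment q i (Function.update x i y) ≤
          (stagHunt n).expUtility i x + (stagHunt n).expPayment q i x) ∧
      ∃ p ∈ Set.Icc (0 : ℝ) 1,
        1 / ((n : ℝ) + 1) * (1 - p) ≤
          (stagHunt n).welfare (allStag n) - (stagHunt n).welfare x ∧
        1 / ((n : ℝ) + 1) * (3 / 8 * p) ≤ ∑ i, (stagHunt n).expPayment q i x := by
  have hn2 : (2 : ℝ) ≤ n := by exact_mod_cast hn
  have hgap : ∀ (x : Profile (StagHuntAct n)) i, 1 / ((n : ℝ) + 1) * (1 - stagProb (x i)) ≤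
      (stagHunt n).welfare (allStag n) - (stagHunt n).welfare x := by
    intro x i
    refine le_trans (mul_le_mul_of_nonneg_left ?_ (by positivity)) (le_welfareGap x i)
    nlinarith [stagProb_le_one (x i)]
  -- The threshold `3/8` leaves `1/8` of the solo reward `1/2` for Hare to outweigh `P / n`.
  by_cases hq : ∀ i, (q i (soloTerminal i stag) : ℝ) ≤ 3 / 8
  · refine ⟨allHare n, fun i y => ?_, 0, ⟨le_rfl, zero_le_one⟩, ?_, ?_⟩
    · have h1 := expPayment_update_allHare_le q i y
      rw [expUtility_update_allHare hn]
      have h2 : P / n ≤ 1 / 8 := by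
        rw [div_le_iff₀ (by linarith)]
        linarith
      have h3 : 1 / ((n : ℝ) + 1) * (stagProb y * (q i (soloTerminal i stag) + P / n)) ≤
          1 / ((n : ℝ) + 1) * (stagProb y / 2) := by
        refine mul_le_mul_of_nonneg_left ?_ (by positivity)
        nlinarith [stagProb_nonneg y, hq i]
      linarith
    · have := hgap (allHare n) ⟨0, by omega⟩
      rwa [stagProb_allHare] at this
    · rw [mul_zero, mul_zero]
      exact Finset.sum_nonneg fun i _ => expPayment_nonneg _ _ _ _
  · push Not at hq
    obtain ⟨i, hi⟩ := hq
    obtain ⟨x, hx⟩ := exists_equilibrium (stagHunt n) (fun i z => (stagHunt n).utility i z + q i z)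
    refine ⟨x, fun j y => ?_, stagProb (x i), ⟨stagProb_nonneg _, stagProb_le_one _⟩,
      hgap x i, ?_⟩
    · rw [expUtility_add_expPayment, expUtility_add_expPayment]
      exact hx j y
    · refine le_trans ?_ ((le_expPayment q i x).trans (Finset.single_le_sum
        (f := fun i => (stagHunt n).expPayment q i x)
        (fun i _ => expPayment_nonneg _ _ _ _) (Finset.mem_univ i)))
      refine mul_le_mul_of_nonneg_left ?_ (by positivity)
      nlinarith [stagProb_nonneg (x i)]

end StagHunt

/-! ### The impossibility of steering -/

theorem mainTheorem3 (P : ℝ) (hP : 0 < P) :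
    ∃ (n : ℕ) (_ : NeZero n), 2 ≤ n ∧ (n : ℝ) ≤ 8 * P + 2 ∧
      ((stagHunt n).numNodes : ℝ) ≤ 2 * (8 * P + 3) ^ 2 ∧
      (stagHunt n).PerfectRecall ∧
      (stagHunt n).IsNash (allStag n) ∧
      (∀ x : GameTree.Profile (StagHuntAct n), x ≠ allStag n →
        (stagHunt n).welfare x < (stagHunt n).welfare (allStag n)) ∧
      ∃ response : (stagHunt n).Payments P → GameTree.Profile (StagHuntAct n),
        ∀ (M : (stagHunt n).TrajectoryMediator P) (z : ℕ → ℕ → (stagHunt n).Terminal)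
          (q : ℕ → ℕ → (stagHunt n).Payments P)
          (x : ℕ → ℕ → GameTree.Profile (StagHuntAct n)),
          q = M.payments z → (∀ T t, x T t = response (q T t)) →
          (∀ T i, (stagHunt n).regret (q T) (x T) T i ≤ 0) ∧
          (∀ T t, 1 / (4 * ((n : ℝ) + 1)) ≤
            ((stagHunt n).welfare (allStag n) - (stagHunt n).welfare (x T t))
              + ∑ i, (stagHunt n).expPayment (q T t) i (x T t)) ∧
          (∀ T, 0 < T →
            1 / (4 * ((n : ℝ) + 1)) ≤ (stagHunt n).avgWelfareGap (allStag n) (x T) T ∨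
            1 / (4 * ((n : ℝ) + 1)) ≤ ∑ i, (stagHunt n).avgPayment (q T) (x T) T i) ∧
          ¬ (stagHunt n).Steered (allStag n) q x := by
  have hfl := Nat.floor_le (by positivity : 0 ≤ 8 * P)
  have hlt := Nat.lt_floor_add_one (8 * P)
  -- The summand `2` ensures `2 ≤ n` even for small `P`, and gives `8P ≤ n ≤ 8P + 2`.
  obtain ⟨n, hn⟩ : ∃ n, n = ⌊8 * P⌋₊ + 2 := ⟨_, rfl⟩
  have hnR : (n : ℝ) = ⌊8 * P⌋₊ + 2 := by rw [hn]; push_cast; rfl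
  have hn2 : 2 ≤ n := by omega
  have : NeZero n := ⟨by omega⟩
  refine ⟨n, inferInstance, hn2, by linarith, ?_, perfectRecall_stagHunt, isNash_allStag,
    fun x hx => welfare_lt_welfare_allStag hx, ?_⟩
  · rw [numNodes_stagHunt]
    push_cast
    have : (n : ℝ) + 1 ≤ 8 * P + 3 := by linarith
    gcongr
  -- The equilibrium is chosen from the payment functions alone, so neither the mediator nor the
  -- observed nodes matter below.
  choose response hNash p hp hgap hpay using
    exists_bad_equilibrium (P := P) hn2 (by linarith : 8 * P ≤ n)
  refine ⟨response, fun M z q x _ hx => ?_⟩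
  have hε : 1 / (4 * ((n : ℝ) + 1)) = 1 / ((n : ℝ) + 1) * (1 / 4) := by
    rw [one_div_mul_one_div, mul_comm]
  have hu : 0 < 1 / ((n : ℝ) + 1) := by positivity
  -- In units of `1 / (n + 1)`, the gap plus twice the payment is at least `(1 - p) + (3/4)p ≥ 3/4`.
  -- This bound is linear and survives averaging over rounds in which `p` differs. If the average
  -- gap and the average payment were both below `1/4`, the weighted sum would be below `3/4`.
  have hweighted : ∀ T t, 3 * (1 / (4 * ((n : ℝ) + 1))) ≤
      ((stagHunt n).welfare (allStag n) - (stagHunt n).welfare (x T t))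
        + 2 * ∑ i, (stagHunt n).expPayment (q T t) i (x T t) := by
    intro T t
    rw [hx, hε]
    have := (hp (q T t)).2
    nlinarith [hgap (q T t), hpay (q T t)]
  have hround : ∀ T, 0 < T →
      1 / (4 * ((n : ℝ) + 1)) ≤ (stagHunt n).avgWelfareGap (allStag n) (x T) T ∨
      1 / (4 * ((n : ℝ) + 1)) ≤ ∑ i, (stagHunt n).avgPayment (q T) (x T) T i := by
    intro T hT
    have hT' : (0 : ℝ) < T := by exact_mod_cast hT
    have hsum := Finset.card_nsmul_le_sum (Finset.range T) _ _ fun t _ => hweighted T t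
    rw [Finset.card_range, nsmul_eq_mul, Finset.sum_add_distrib, Finset.sum_sub_distrib,
      Finset.sum_const, Finset.card_range, nsmul_eq_mul, ← Finset.mul_sum, Finset.sum_comm] at hsum
    have havg : 3 * (1 / (4 * ((n : ℝ) + 1))) ≤
        (stagHunt n).avgWelfareGap (allStag n) (x T) T
          + 2 * ∑ i, (stagHunt n).avgPayment (q T) (x T) T i := by
      have h := mul_le_mul_of_nonneg_left hsum (by positivity : 0 ≤ 1 / (T : ℝ))
      simp only [GameTree.avgWelfareGap, GameTree.avgPayment, ← Finset.mul_sum]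
      refine le_trans (le_of_eq ?_) (h.trans (le_of_eq ?_)) <;> field_simp
    by_contra! hcon
    linarith [hcon.1, hcon.2]
  refine ⟨fun T i => ?_, fun T t => ?_, hround, ?_⟩
  · refine GameTree.regret_nonpos _ hP (fun t y => ?_) T
    rw [hx]
    exact hNash (q T t) i y
  · rw [hx, hε]
    have := (hp (q T t)).2
    -- Here `(1 - p) + (3/8)p ≥ 3/8`, which exceeds `1/4`.
    nlinarith [hgap (q T t), hpay (q T t), (hp (q T t)).1]
  · exact GameTree.not_steered_of_le _ _ _ _ (by positivity) hround
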